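/- Let $V:\mathbb{R}\to[0,\infty)$ be an Orlicz function, i.e. convex and symmetric with $V(0)=0$ and $V(x)>0$ for $x\neq 0$. Let $p\in(1,\infty)$ be such that $V(x)/|x|^p\to\infty$ as $|x|\to\infty$, let $R\in(0,\infty)$, and for each $n\in\mathbb{N}$, $n\ge 1$, let $X_R^{n,V}$ be uniformly distributed on the Orlicz ball $\mathbb{B}_R^{n,V}=\{x\in\mathbb{R}^n:\sum_{k=1}^n V(x_k)\le Rn\}$. For a Borel probability measure $\nu$ on $\mathbb{R}$ write $m_V(\nu)=\int V\,d\nu$ and $m_p(\nu)=\int|x|^p\,\nu(dx)$, both in $[0,\infty]$, and let $h(\nu)=-\int_{\mathbb{R}}\log\frac{d\nu}{dx}(x)\,\nu(dx)$ if $\nu$ has a Lebesgue density $\frac{d\nu}{dx}$ and $h(\nu)=-\infty$ otherwise (if $m_V(\nu)<\infty$, then $h(\nu)\in[-\infty,\infty)$ is well defined). Define $J_p^V:\mathbb{R}\to[0,\infty]$ by $$ J_p^V(x)=\begin{cases}-\max_{\alpha<0}\Big\{\alpha R-\log\int_{\mathbb{R}}e^{\alpha V(t)}\,dt\Big\}-\max\Big\{h(\nu):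 m_p(\nu)^{1/p}=x,\ m_V(\nu)\le R\Big\}&: x\ge 0,\\ \infty&: x<0,\end{cases} $$ where the maximum over the empty set is $-\infty$. Then the first maximum is attained, the second one is attained whenever the set of admissible $\nu$ is non-empty, and the sequence $\big(n^{-1/p}\|X_R^{n,V}\|_p\big)_{n\in\mathbb{N}}$ satisfies a large deviation principle in $\mathbb{R}$ with good rate function $J_p^V$. That is, $J_p^V\geq 0$, the sets $\{J_p^V\le a\}$, $a\in\mathbb{R}$, are compact, and for every Borel set $A\subseteq\mathbb{R}$, with interior $A^\circ$ and closure $\overline{A}$, $$ -\inf_{x\in A^\circ}J_p^V(x)\le\liminf_{n\to\infty}\tfrac1n\log\mathbb{P}\big[n^{-1/p}\|X_R^{n,V}\|_p\in A^\circ\big]\le\limsup_{n\to\infty}\tfrac1n\log\mathbb{P}\big[n^{-1/p}\|X_R^{n,V}\|_p\in\overline{A}\big]\le-\inf_{x\in\overline{A}}J_p^V(x). $$ -/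

import Mathlib

open MeasureTheory ProbabilityTheory Filter Topology
open scoped ENNReal

noncomputable section

/-- An Orlicz function: convex, symmetric, vanishing at `0` and positive elsewhere. -/
structure IsOrlicz (V : ℝ → ℝ) : Prop where
  convexOn : ConvexOn ℝ Set.univ V
  symm : ∀ x, V (-x) = V x
  map_zero : V 0 = 0
  pos : ∀ x, x ≠ 0 → 0 < V x

/-- The Orlicz ball `{x ∈ ℝⁿ : ∑ₖ V(xₖ) ≤ R n}`. -/
def orliczBall (V : ℝ → ℝ) (R : ℝ) (n : ℕ) : Set (Fin n → ℝ) :=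
  {x | ∑ k, V (x k) ≤ R * n}

/-- The moment `m_V(ν) = ∫ V dν ∈ [0, ∞]` of a nonnegative function `V`. -/
def moment_of (V : ℝ → ℝ) (ν : ProbabilityMeasure ℝ) : ℝ≥0∞ :=
  ∫⁻ x, ENNReal.ofReal (V x) ∂(ν : Measure ℝ)

open Classical in
/-- The differential entropy `h(ν) = -∫ log (dν/dx) dν`, with value in `[-∞, ∞]`. The integral is
the difference of the integrals of the positive and negative parts of `-log (dν/dx)`, where
`∞ - ∞` is `-∞` by the convention of `EReal`. It is `-∞` if `ν` has no Lebesgue density. -/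
def diffEntropy (ν : ProbabilityMeasure ℝ) : EReal :=
  if (ν : Measure ℝ) ≪ volume then
    ((∫⁻ x, ENNReal.ofReal (-Real.log ((ν : Measure ℝ).rnDeriv volume x).toReal)
        ∂(ν : Measure ℝ) : ℝ≥0∞) : EReal)
      - ((∫⁻ x, ENNReal.ofReal (Real.log ((ν : Measure ℝ).rnDeriv volume x).toReal)
        ∂(ν : Measure ℝ) : ℝ≥0∞) : EReal)
  else ⊥

/-- A good rate function: `[0, ∞]`-valued with compact sublevel sets. -/
structure IsGoodRateFunction {E : Type*} [TopologicalSpace E] (I : E → EReal) : Prop where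
  nonneg : ∀ x, 0 ≤ I x
  isCompact_sublevel : ∀ a : ℝ, IsCompact {x | I x ≤ (a : EReal)}

/-- The random variables `ξ n : Ω n → E` satisfy a large deviation principle (speed `n`) with good
rate function `I`. Probabilities of a Borel set enter through
`ENNReal.log (P n (ξ n ⁻¹' A)) / n ∈ [-∞, 0]`, with `log 0 = -∞`. -/
structure SatisfiesLDP {E : Type*} [TopologicalSpace E] [MeasurableSpace E]
    {Ω : ℕ → Type*} [∀ n, MeasurableSpace (Ω n)] (P : ∀ n, Measure (Ω n))
    (ξ : ∀ n, Ω n → E) (I : E → EReal) : Prop where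
  isGoodRateFunction : IsGoodRateFunction I
  lower : ∀ A : Set E, MeasurableSet A →
    -(⨅ x ∈ interior A, I x) ≤
      liminf (fun n : ℕ => ENNReal.log (P n (ξ n ⁻¹' interior A)) / (n : EReal)) atTop
  upper : ∀ A : Set E, MeasurableSet A →
    limsup (fun n : ℕ => ENNReal.log (P n (ξ n ⁻¹' closure A)) / (n : EReal)) atTop ≤
      -(⨅ x ∈ closure A, I x)

/-- The function `α ↦ α R - log ∫ exp (α V(t)) dt` (considered for `α < 0`). -/
def gibbsDual (V : ℝ → ℝ) (R α : ℝ) : ℝ :=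
  α * R - Real.log (∫ t, Real.exp (α * V t))

/-- The laws `ν` with `m_p(ν)^(1/p) = x` and `m_V(ν) ≤ R` (for `x ≥ 0`). -/
def entropyConstraint (V : ℝ → ℝ) (p R x : ℝ) : Set (ProbabilityMeasure ℝ) :=
  {ν | moment_of (fun t => |t| ^ p) ν ^ (1 / p) = ENNReal.ofReal x ∧
    moment_of V ν ≤ ENNReal.ofReal R}

open Classical in
/-- The rate function: for `x ≥ 0`,
`-max_{α < 0} (α R - log ∫ exp (α V)) - max {h(ν) : m_p(ν)^(1/p) = x, m_V(ν) ≤ R}`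
(the maximum over the empty set being `-∞`), and `∞` for `x < 0`. -/
def thinShellRate (V : ℝ → ℝ) (p R x : ℝ) : EReal :=
  if 0 ≤ x then
    -(⨆ α ∈ Set.Iio (0 : ℝ), (gibbsDual V R α : EReal))
      - (⨆ ν ∈ entropyConstraint V p R x, diffEntropy ν)
  else ⊤

end

/-! ### Orlicz functions -/

namespace IsOrlicz

variable {V : ℝ → ℝ}

/-! The probability in question is a ratio of volumes: the part of the Orlicz ball whose `p`-th mean
lies in a given set, over the whole ball. Both volumes are governed by entropy: on the exponential
scale, the volume of such a part is `exp (n * s)`, where `s` is the supremum of `densityEntropy f`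
over densities with `∫ V f ≤ R` and `p`-th moment in the set.

The upper bound (`log_volume_le_densityEntropy`) holds for every `n ≥ 1`: the averaged marginal of
the uniform law inherits the constraints, which are linear, and subadditivity of entropy gives `log
vol ≤ n h(f)`. The lower bound (`IsAdmissible.eventually_le_volume`) counts volume: by the law of
large numbers the product density `f ⊗ ⋯ ⊗ f` concentrates where it is about `exp (-n h(f))`. For
the whole ball the entropy maximum is computed by Lagrange duality: the Gibbs density `exp (α V) /
Z` with optimal `α < 0` attains `-gibbsDual V R α`.

What remains is compactness (`exists_isAdmissible_of_forall_pos`). Entropy is uniformly concave in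
Hellinger distance, so near-maximisers form a Cauchy sequence of square roots in `L²`. Since `V`
grows faster than `|t| ^ p`, the `p`-th moment passes to the limit, and entropy is upper
semicontinuous along it. Hence the maximum is attained and sublevel sets are closed;
`thinShellRate_le_iff` replaces the rate function by the existence of one density. The `p`-th means
stay in a fixed compact interval, so a finite cover gives the upper bound for all closed sets. -/

theorem continuous (hV : IsOrlicz V) : Continuous V :=
  continuousOn_univ.1 (hV.convexOn.continuousOn isOpen_univ)

theorem nonneg (hV : IsOrlicz V) (x : ℝ) : 0 ≤ V x := by
  rcases eq_or_ne x 0 with rfl | hx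
  · exact hV.map_zero.ge
  · exact (hV.pos x hx).le

theorem apply_mul_le (hV : IsOrlicz V) {l : ℝ} (h0 : 0 ≤ l) (h1 : l ≤ 1) (x : ℝ) :
    V (l * x) ≤ l * V x := by
  have := hV.convexOn.2 (Set.mem_univ x) (Set.mem_univ 0) h0 (sub_nonneg.2 h1) (by ring)
  simpa [hV.map_zero] using this

theorem apply_le_of_abs_le (hV : IsOrlicz V) {x T : ℝ} (hT : 0 < T) (h : |x| ≤ T) :
    V x ≤ V T := by
  have habs : V x = V |x| := by
    rcases abs_choice x with h | h <;> rw [h]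
    exact (hV.symm x).symm
  have h1 : |x| / T ≤ 1 := (div_le_one hT).2 h
  have h2 := hV.apply_mul_le (by positivity) h1 T
  rw [div_mul_cancel₀ _ hT.ne'] at h2
  rw [habs]
  exact h2.trans (mul_le_of_le_one_left (hV.nonneg T) h1)

end IsOrlicz

/-! ### Consequences of the growth of `V`: moment domination and exponential integrability -/

section Growth

variable {V : ℝ → ℝ} {p : ℝ}

/-- Off a compact set the ratio `V t / |t| ^ p` exceeds `1 / ε`; on it `|t| ^ p` is bounded. With
`ε` arbitrary, this makes `|t| ^ p` uniformly integrable over densities with `∫ V f ≤ R`. -/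
theorem exists_rpow_le_mul_add (hVp : Tendsto (fun x : ℝ => V x / |x| ^ p) (cocompact ℝ) atTop)
    (hV : IsOrlicz V) (hp : 1 < p) {ε : ℝ} (hε : 0 < ε) :
    ∃ C : ℝ, 0 ≤ C ∧ ∀ t, |t| ^ p ≤ ε * V t + C := by
  have h1 := hVp.eventually_ge_atTop (1 / ε)
  obtain ⟨K, hK, hKs⟩ := mem_cocompact.1 h1
  obtain ⟨C, hC⟩ := hK.isBounded.subset_closedBall 0
  refine ⟨|C| ^ p, by positivity, fun t => ?_⟩
  by_cases ht : t ∈ K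
  · have h2 : |t| ≤ |C| := by
      have := hC ht
      rw [Metric.mem_closedBall, dist_zero_right, Real.norm_eq_abs] at this
      exact this.trans (le_abs_self C)
    have h3 : |t| ^ p ≤ |C| ^ p := Real.rpow_le_rpow (abs_nonneg t) h2 (by linarith)
    have := mul_nonneg hε.le (hV.nonneg t)
    linarith
  · have h2 : 1 / ε ≤ V t / |t| ^ p := hKs ht
    have h0 : 0 ≤ |t| ^ p := by positivity
    have h4 : 0 ≤ |C| ^ p := by positivity
    rcases h0.eq_or_lt with h | h
    · rw [← h]
      have := mul_nonneg hε.le (hV.nonneg t)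
      linarith
    · rw [div_le_div_iff₀ hε h] at h2
      linarith

theorem abs_le_one_add_rpow (hp : 1 < p) (t : ℝ) : |t| ≤ 1 + |t| ^ p := by
  rcases le_total |t| 1 with h | h
  · have : 0 ≤ |t| ^ p := by positivity
    linarith
  · have := Real.rpow_le_rpow_of_exponent_le h hp.le
    rw [Real.rpow_one] at this
    linarith

theorem integrable_exp_neg_mul_abs {b : ℝ} (hb : 0 < b) :
    Integrable (fun t : ℝ => Real.exp (-b * |t|)) := by
  -- The constant is chosen so that multiplying `1 + b² t² / 2 ≤ exp (b |t|)` by it yields at least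
  -- `1 + t²`.
  refine (integrable_inv_one_add_sq.const_mul (1 + 2 / b ^ 2)).mono'
    (by fun_prop) (Eventually.of_forall fun t => ?_)
  rw [Real.norm_eq_abs, Real.abs_exp, neg_mul, Real.exp_neg, ← div_eq_mul_inv,
    inv_eq_one_div, div_le_div_iff₀ (Real.exp_pos _) (by positivity)]
  have h1 := Real.quadratic_le_exp_of_nonneg (x := b * |t|) (by positivity)
  have h3 : 0 ≤ b * |t| := by positivity
  have h2 : (b * |t|) ^ 2 = b ^ 2 * t ^ 2 := by rw [mul_pow, sq_abs]
  rw [h2] at h1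
  have h4 : (1 + 2 / b ^ 2) * (1 + b ^ 2 * t ^ 2 / 2) ≤ (1 + 2 / b ^ 2) * Real.exp (b * |t|) := by
    apply mul_le_mul_of_nonneg_left _ (by positivity)
    linarith
  have h5 : (1 + 2 / b ^ 2) * (1 + b ^ 2 * t ^ 2 / 2)
      = 1 + t ^ 2 + 2 / b ^ 2 + b ^ 2 * t ^ 2 / 2 := by
    field_simp
    ring
  have h6 : 0 ≤ 2 / b ^ 2 + b ^ 2 * t ^ 2 / 2 := by positivity
  linarith

theorem integrable_exp_neg_rpow (hp : 1 < p) :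
    Integrable (fun t : ℝ => Real.exp (-|t| ^ p)) := by
  refine ((integrable_exp_neg_mul_abs one_pos).const_mul (Real.exp 1)).mono'
    (by fun_prop (disch := linarith)) (Eventually.of_forall fun t => ?_)
  rw [Real.norm_eq_abs, Real.abs_exp, ← Real.exp_add, Real.exp_le_exp]
  linarith [abs_le_one_add_rpow hp t]

theorem integrable_exp_mul_of_neg
    (hVp : Tendsto (fun x : ℝ => V x / |x| ^ p) (cocompact ℝ) atTop)
    (hV : IsOrlicz V) (hp : 1 < p) {α : ℝ} (hα : α < 0) :
    Integrable (fun t : ℝ => Real.exp (α * V t)) := by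
  obtain ⟨C, -, hC⟩ := exists_rpow_le_mul_add hVp hV hp one_pos
  have hc := hV.continuous
  refine ((integrable_exp_neg_mul_abs (neg_pos.2 hα)).const_mul (Real.exp (-α * (1 + C)))).mono'
    (by fun_prop) (Eventually.of_forall fun t => ?_)
  rw [Real.norm_eq_abs, Real.abs_exp, ← Real.exp_add, Real.exp_le_exp]
  nlinarith [abs_le_one_add_rpow hp t, hC t]

/-- Lets `∫ exp (α V)` be treated as a moment generating function of `V` under Lebesgue measure,
hence differentiable for `α < 0`. -/
theorem Iio_subset_interior_integrableExpSet
    (hVp : Tendsto (fun x : ℝ => V x / |x| ^ p) (cocompact ℝ) atTop)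
    (hV : IsOrlicz V) (hp : 1 < p) :
    Set.Iio (0 : ℝ) ⊆ interior (integrableExpSet V volume) :=
  isOpen_Iio.subset_interior_iff.2 fun _ hα => integrable_exp_mul_of_neg hVp hV hp hα

end Growth

/-! ### The dual problem -/

section Dual

variable {V : ℝ → ℝ} {p R : ℝ}

theorem integral_exp_mul_pos (hVp : Tendsto (fun x : ℝ => V x / |x| ^ p) (cocompact ℝ) atTop)
    (hV : IsOrlicz V) (hp : 1 < p) {α : ℝ} (hα : α < 0) :
    0 < ∫ t, Real.exp (α * V t) :=
  integral_exp_pos (integrable_exp_mul_of_neg hVp hV hp hα)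

theorem mul_exp_le_integral_exp
    (hVp : Tendsto (fun x : ℝ => V x / |x| ^ p) (cocompact ℝ) atTop)
    (hV : IsOrlicz V) (hp : 1 < p) {α : ℝ} (hα : α < 0) {T : ℝ} (hT : 0 < T) :
    2 * T * Real.exp (α * V T) ≤ ∫ t, Real.exp (α * V t) := by
  have hi := integrable_exp_mul_of_neg hVp hV hp hα
  calc 2 * T * Real.exp (α * V T) = ∫ t in Set.Icc (-T) T, Real.exp (α * V T) := by
        rw [setIntegral_const, Measure.real, Real.volume_Icc, ENNReal.toReal_ofReal (by linarith),
          smul_eq_mul]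
        ring
    _ ≤ ∫ t in Set.Icc (-T) T, Real.exp (α * V t) := by
        refine setIntegral_mono_on (by simp) hi.integrableOn measurableSet_Icc fun t ht => ?_
        rw [Real.exp_le_exp]
        exact mul_le_mul_of_nonpos_left (hV.apply_le_of_abs_le hT (abs_le.2 ht)) hα.le
    _ ≤ ∫ t, Real.exp (α * V t) :=
        setIntegral_le_integral hi (Eventually.of_forall fun t => (Real.exp_pos _).le)

/-- Comes from integrating over `[-T, T]` only, where `V ≤ V T`. A large `T` controls the dual near
`0`, a small `T` near `-∞`. -/
theorem gibbsDual_le (hVp : Tendsto (fun x : ℝ => V x / |x| ^ p) (cocompact ℝ) atTop)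
    (hV : IsOrlicz V) (hp : 1 < p) {α : ℝ} (hα : α < 0) {T : ℝ} (hT : 0 < T) :
    gibbsDual V R α ≤ α * R - Real.log (2 * T) - α * V T := by
  have h := Real.log_le_log (by positivity) (mul_exp_le_integral_exp hVp hV hp hα hT)
  rw [Real.log_mul (by positivity) (Real.exp_ne_zero _), Real.log_exp] at h
  unfold gibbsDual
  linarith

theorem hasDerivAt_gibbsDual (hVp : Tendsto (fun x : ℝ => V x / |x| ^ p) (cocompact ℝ) atTop)
    (hV : IsOrlicz V) (hp : 1 < p) {α : ℝ} (hα : α < 0) :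
    HasDerivAt (gibbsDual V R)
      (R - (∫ t, V t * Real.exp (α * V t)) / ∫ t, Real.exp (α * V t)) α := by
  have h := hasDerivAt_mgf (Iio_subset_interior_integrableExpSet hVp hV hp hα)
  have h2 : HasDerivAt (gibbsDual V R) _ α := ((hasDerivAt_id α).mul_const R).sub
    (h.log (integral_exp_mul_pos hVp hV hp hα).ne')
  simpa [mgf] using h2

theorem exists_isMaxOn_gibbsDual
    (hVp : Tendsto (fun x : ℝ => V x / |x| ^ p) (cocompact ℝ) atTop)
    (hV : IsOrlicz V) (hp : 1 < p) (hR : 0 < R) :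
    ∃ α ∈ Set.Iio (0 : ℝ), IsMaxOn (gibbsDual V R) (Set.Iio 0) α := by
  set g := gibbsDual V R with hg
  have hcont : ContinuousOn g (Set.Iio 0) := fun α hα =>
    (hasDerivAt_gibbsDual hVp hV hp hα).continuousAt.continuousWithinAt
  -- behaviour near `0`
  obtain ⟨b, hb0, hb1, hb⟩ : ∃ b : ℝ, b < 0 ∧ -1 < b ∧ ∀ α ∈ Set.Ioo b 0, g α ≤ g (-1) := by
    -- Chosen so that `log (2 T) = 1 - g (-1)`; the spare `1` absorbs `-α V T` once `α ≥ -1 / V T`.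
    set T : ℝ := Real.exp (1 - g (-1)) / 2 with hTdef
    have hT : 0 < T := by positivity
    have hVT : 0 < V T := hV.pos T hT.ne'
    refine ⟨max (-1 / 2) (-(1 / V T)), max_lt (by norm_num) (neg_lt_zero.2 (by positivity)),
      lt_max_of_lt_left (by norm_num), fun α hα => ?_⟩
    have h1 : -(1 / V T) < α := lt_of_le_of_lt (le_max_right _ _) hα.1
    have h2 : -1 ≤ α * V T := by
      have := mul_le_mul_of_nonneg_right h1.le hVT.le
      rwa [neg_mul, one_div, inv_mul_cancel₀ hVT.ne'] at this
    have h3 := gibbsDual_le (R := R) hVp hV hp hα.2 hT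
    rw [hTdef, mul_div_cancel₀ _ (two_ne_zero), Real.log_exp, ← hTdef] at h3
    have := mul_neg_of_neg_of_pos hα.2 hR
    linarith
  -- behaviour near `-∞`
  obtain ⟨a, hab, ha⟩ : ∃ a : ℝ, a < -1 ∧ ∀ α ≤ a, g α ≤ g (-1) := by
    -- With `V T ≤ R / 2` the bound is at most `α R / 2 - log (2 T)`, which tends to `-∞` with `α`.
    obtain ⟨T, hT, hVT⟩ : ∃ T : ℝ, 0 < T ∧ V T ≤ R / 2 := by
      have h0 : Tendsto V (𝓝[>] 0) (𝓝 0) := by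
        have := hV.continuous.tendsto 0
        rw [hV.map_zero] at this
        exact this.mono_left nhdsWithin_le_nhds
      obtain ⟨T, h1, h2⟩ := ((h0.eventually_le_const (half_pos hR)).and
        self_mem_nhdsWithin).exists
      exact ⟨T, h2, h1⟩
    refine ⟨min (-2) ((g (-1) + Real.log (2 * T)) * (2 / R)),
      lt_of_le_of_lt (min_le_left _ _) (by norm_num), fun α hα => ?_⟩
    have hα0 : α < 0 := lt_of_le_of_lt (hα.trans (min_le_left _ _)) (by norm_num)
    have h1 := hα.trans (min_le_right _ _)
    have h3 := gibbsDual_le (R := R) hVp hV hp hα0 hT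
    have h4 : α * (R / 2) ≤ g (-1) + Real.log (2 * T) := by
      have := mul_le_mul_of_nonneg_right h1 (half_pos hR).le
      calc α * (R / 2) ≤ _ := this
        _ = g (-1) + Real.log (2 * T) := by field_simp
    nlinarith
  obtain ⟨α, hα, hmax⟩ := isCompact_Icc.exists_isMaxOn (s := Set.Icc a b)
    ⟨-1, hab.le, hb1.le⟩ (hcont.mono fun x hx => lt_of_le_of_lt hx.2 hb0)
  refine ⟨α, lt_of_le_of_lt hα.2 hb0, fun x hx => ?_⟩
  have h1 : g (-1) ≤ g α := hmax ⟨hab.le, hb1.le⟩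
  rcases le_or_gt x a with h | h
  · exact (ha x h).trans h1
  rcases le_or_gt x b with h' | h'
  · exact hmax ⟨h.le, h'⟩
  · exact (hb x ⟨h', hx⟩).trans h1

end Dual

/-! ### Admissible densities -/

/-- Probability densities `f` on `ℝ` with `∫ V f ≤ R`, `∫ |t|^p f = y` and integrable
`f log f`. -/
structure IsAdmissible (V : ℝ → ℝ) (p R y : ℝ) (f : ℝ → ℝ) : Prop where
  measurable : Measurable f
  nonneg : ∀ t, 0 ≤ f t
  integrable : Integrable f
  integral_eq_one : ∫ t, f t = 1
  integrable_V : Integrable fun t => V t * f t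
  integral_V_le : ∫ t, V t * f t ≤ R
  integrable_rpow : Integrable fun t => |t| ^ p * f t
  integral_rpow : ∫ t, |t| ^ p * f t = y
  integrable_negMulLog : Integrable fun t => Real.negMulLog (f t)

/-- The entropy `-∫ f log f` of a density. -/
noncomputable def densityEntropy (f : ℝ → ℝ) : ℝ := ∫ t, Real.negMulLog (f t)

/-- This is `log u ≤ u - 1` at `u = g / a`, the pointwise form of Gibbs' inequality. It is applied
with `g` a Gibbs density, `exp (-V)` or `exp (-|t| ^ p)`. -/
theorem negMulLog_le_of_pos {a g : ℝ} (ha : 0 ≤ a) (hg : 0 < g) :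
    Real.negMulLog a ≤ -(a * Real.log g) + g - a := by
  rcases ha.eq_or_lt with rfl | ha
  · simpa using hg.le
  · have h := Real.log_le_sub_one_of_pos (div_pos hg ha)
    rw [Real.log_div hg.ne' ha.ne'] at h
    have h2 := mul_le_mul_of_nonneg_left h ha.le
    rw [mul_sub, mul_sub, mul_div_cancel₀ _ ha.ne'] at h2
    unfold Real.negMulLog
    linarith

section Admissible

variable {V : ℝ → ℝ} {p R y : ℝ} {f : ℝ → ℝ}

/-- Weak duality: compare `f` with the Gibbs density. The sign of `α` is what allows the inequality
`∫ V f ≤ R` to be used. -/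
theorem IsAdmissible.densityEntropy_le
    (hf : IsAdmissible V p R y f)
    (hVp : Tendsto (fun x : ℝ => V x / |x| ^ p) (cocompact ℝ) atTop)
    (hV : IsOrlicz V) (hp : 1 < p) {α : ℝ} (hα : α < 0) :
    densityEntropy f ≤ -gibbsDual V R α := by
  set Z := ∫ t, Real.exp (α * V t) with hZ
  have hZpos : 0 < Z := integral_exp_mul_pos hVp hV hp hα
  have hi := integrable_exp_mul_of_neg hVp hV hp hα
  have i1 := hf.integrable_V.const_mul (-α)
  have i2 := hf.integrable.mul_const (Real.log Z - 1)
  have i3 := hi.div_const Z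
  have hle : densityEntropy f ≤
      ∫ t, (-α * (V t * f t) + f t * (Real.log Z - 1) + Real.exp (α * V t) / Z) := by
    refine integral_mono hf.integrable_negMulLog ((i1.add i2).add i3) fun t => ?_
    have h := negMulLog_le_of_pos (hf.nonneg t) (div_pos (Real.exp_pos (α * V t)) hZpos)
    rw [Real.log_div (Real.exp_ne_zero _) hZpos.ne', Real.log_exp] at h
    refine h.trans (le_of_eq ?_)
    ring
  have heq : ∫ t, (-α * (V t * f t) + f t * (Real.log Z - 1) + Real.exp (α * V t) / Z)
      = -α * (∫ t, V t * f t) + (∫ t, f t) * (Real.log Z - 1) + Z / Z := by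
    rw [integral_add (by exact i1.add i2) i3, integral_add i1 i2, integral_const_mul,
      integral_mul_const, integral_div]
  rw [heq, hf.integral_eq_one, div_self hZpos.ne'] at hle
  have h3 := mul_le_mul_of_nonneg_left hf.integral_V_le (neg_pos.2 hα).le
  unfold gibbsDual
  rw [← hZ]
  linarith

/-- Strong duality: the vanishing derivative at `α` says that the Gibbs density has `∫ V f = R`
exactly, so weak duality is an equality for it. -/
theorem exists_isAdmissible_of_isMaxOn
    (hVp : Tendsto (fun x : ℝ => V x / |x| ^ p) (cocompact ℝ) atTop)
    (hV : IsOrlicz V) (hp : 1 < p) {α : ℝ} (hα : α < 0)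
    (hmax : IsMaxOn (gibbsDual V R) (Set.Iio 0) α) :
    ∃ y f, IsAdmissible V p R y f ∧ densityEntropy f = -gibbsDual V R α := by
  set Z := ∫ t, Real.exp (α * V t) with hZ
  have hZpos : 0 < Z := integral_exp_mul_pos hVp hV hp hα
  have hi := integrable_exp_mul_of_neg hVp hV hp hα
  have hc := hV.continuous
  have hiV : Integrable fun t => V t * Real.exp (α * V t) := by
    have h := integrable_pow_mul_exp_of_mem_interior_integrableExpSet
      (Iio_subset_interior_integrableExpSet hVp hV hp hα) 1
    simpa using h
  have hd : R - (∫ t, V t * Real.exp (α * V t)) / Z = 0 :=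
    IsLocalMax.hasDerivAt_eq_zero (hmax.isLocalMax (Iio_mem_nhds hα))
      (hasDerivAt_gibbsDual hVp hV hp hα)
  have hVR : ∫ t, V t * (Real.exp (α * V t) / Z) = R := by
    simp_rw [← mul_div_assoc]
    rw [integral_div]
    linarith
  have iV : Integrable fun t => V t * (Real.exp (α * V t) / Z) := by
    simp_rw [← mul_div_assoc]
    exact hiV.div_const Z
  have i0 : Integrable fun t => Real.exp (α * V t) / Z := hi.div_const Z
  have hone : ∫ t, Real.exp (α * V t) / Z = 1 := by
    rw [integral_div, div_self hZpos.ne']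
  have hneg : ∀ t, Real.negMulLog (Real.exp (α * V t) / Z)
      = -α * (V t * (Real.exp (α * V t) / Z)) + Real.log Z * (Real.exp (α * V t) / Z) := by
    intro t
    rw [Real.negMulLog, Real.log_div (Real.exp_ne_zero _) hZpos.ne', Real.log_exp]
    ring
  obtain ⟨C, hC0, hC⟩ := exists_rpow_le_mul_add hVp hV hp one_pos
  refine ⟨_, fun t => Real.exp (α * V t) / Z, ⟨by fun_prop, fun t => by positivity, i0, hone, iV,
    hVR.le, ?_, rfl, ?_⟩, ?_⟩
  · refine (iV.add (i0.const_mul C)).mono' ?_ (Eventually.of_forall fun t => ?_)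
    · have : Continuous fun t : ℝ => |t| ^ p :=
        continuous_abs.rpow_const fun _ => Or.inr (by linarith)
      fun_prop
    · have h0 : 0 ≤ Real.exp (α * V t) / Z := by positivity
      rw [Real.norm_eq_abs, abs_of_nonneg (by positivity)]
      have := mul_le_mul_of_nonneg_right (hC t) h0
      simp only [Pi.add_apply]
      linarith
  · simp_rw [hneg]
    exact (iV.const_mul _).add (i0.const_mul _)
  · unfold densityEntropy
    simp_rw [hneg]
    rw [integral_add (iV.const_mul _) (i0.const_mul _), integral_const_mul, integral_const_mul,
      hone, hVR, gibbsDual]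
    ring

theorem IsAdmissible.nonneg_moment (hf : IsAdmissible V p R y f) : 0 ≤ y := by
  rw [← hf.integral_rpow]
  exact integral_nonneg fun t => mul_nonneg (by positivity) (hf.nonneg t)

theorem IsAdmissible.moment_le (hf : IsAdmissible V p R y f) {ε C : ℝ} (hε : 0 ≤ ε)
    (hC : ∀ t, |t| ^ p ≤ ε * V t + C) : y ≤ ε * R + C := by
  rw [← hf.integral_rpow]
  calc ∫ t, |t| ^ p * f t ≤ ∫ t, (ε * (V t * f t) + C * f t) := by
        refine integral_mono hf.integrable_rpow
          ((hf.integrable_V.const_mul ε).add (hf.integrable.const_mul C)) fun t => ?_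
        have := mul_le_mul_of_nonneg_right (hC t) (hf.nonneg t)
        simp only
        linarith
    _ = ε * (∫ t, V t * f t) + C * ∫ t, f t := by
        rw [integral_add (hf.integrable_V.const_mul ε) (hf.integrable.const_mul C),
          integral_const_mul, integral_const_mul]
    _ ≤ ε * R + C := by
        rw [hf.integral_eq_one, mul_one]
        have := mul_le_mul_of_nonneg_left hf.integral_V_le hε
        linarith

end Admissible

/-! ### Measures with finite entropy and admissible densities -/

section Bridge

variable {V : ℝ → ℝ} {p R x : ℝ} {f : ℝ → ℝ} {ν : ProbabilityMeasure ℝ}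

theorem lintegral_ofReal_withDensity (hf : Measurable f) (h0 : ∀ t, 0 ≤ f t) {g : ℝ → ℝ}
    (hg : Measurable g) :
    ∫⁻ t, ENNReal.ofReal (g t) ∂(volume.withDensity fun t => ENNReal.ofReal (f t))
      = ∫⁻ t, ENNReal.ofReal (g t * f t) := by
  rw [lintegral_withDensity_eq_lintegral_mul _ hf.ennreal_ofReal hg.ennreal_ofReal]
  refine lintegral_congr fun t => ?_
  rw [Pi.mul_apply, mul_comm, ENNReal.ofReal_mul' (h0 t)]

theorem integrable_and_integral_eq_of_lintegral_ofReal {g : ℝ → ℝ} (hg : Measurable g)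
    (h0 : ∀ t, 0 ≤ g t) {c : ℝ} (hc : 0 ≤ c)
    (h : ∫⁻ t, ENNReal.ofReal (g t) ≤ ENNReal.ofReal c) :
    Integrable g ∧ ∫ t, g t ≤ c := by
  refine ⟨⟨hg.aestronglyMeasurable, ?_⟩, ?_⟩
  · rw [hasFiniteIntegral_iff_ofReal (Eventually.of_forall h0)]
    exact h.trans_lt ENNReal.ofReal_lt_top
  · rw [integral_eq_lintegral_of_nonneg_ae (Eventually.of_forall h0) hg.aestronglyMeasurable]
    exact ENNReal.toReal_le_of_le_ofReal hc h

theorem diffEntropy_eq_lintegral (hf : Measurable f) (h0 : ∀ t, 0 ≤ f t)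
    (hν : (ν : Measure ℝ) = volume.withDensity fun t => ENNReal.ofReal (f t)) :
    diffEntropy ν = ((∫⁻ t, ENNReal.ofReal (Real.negMulLog (f t)) : ℝ≥0∞) : EReal)
      - ((∫⁻ t, ENNReal.ofReal (-Real.negMulLog (f t)) : ℝ≥0∞) : EReal) := by
  have hac : (ν : Measure ℝ) ≪ volume := by
    rw [hν]
    exact withDensity_absolutelyContinuous _ _
  have hae : ∀ᵐ t ∂(ν : Measure ℝ), ((ν : Measure ℝ).rnDeriv volume t).toReal = f t := by
    refine hac.ae_le ?_
    rw [hν]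
    filter_upwards [Measure.rnDeriv_withDensity volume hf.ennreal_ofReal] with t ht
    rw [ht, ENNReal.toReal_ofReal (h0 t)]
  -- The signs `s = -1` and `s = 1` give the positive and the negative part at once.
  have key : ∀ s : ℝ, ∫⁻ t, ENNReal.ofReal (s * Real.log
      ((ν : Measure ℝ).rnDeriv volume t).toReal) ∂(ν : Measure ℝ)
      = ∫⁻ t, ENNReal.ofReal (-s * Real.negMulLog (f t)) := by
    intro s
    rw [lintegral_congr_ae (g := fun t => ENNReal.ofReal (s * Real.log (f t)))
      (by filter_upwards [hae] with t ht; rw [ht]), hν,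
      lintegral_ofReal_withDensity hf h0 (g := fun t => s * Real.log (f t)) (by fun_prop)]
    refine lintegral_congr fun t => ?_
    congr 1
    unfold Real.negMulLog
    ring
  have k1 := key (-1)
  have k2 := key 1
  simp only [neg_mul, one_mul, neg_neg] at k1 k2
  rw [diffEntropy, if_pos hac, k1, k2]

theorem diffEntropy_eq_densityEntropy (hf : Measurable f) (h0 : ∀ t, 0 ≤ f t)
    (hν : (ν : Measure ℝ) = volume.withDensity fun t => ENNReal.ofReal (f t))
    (hi : Integrable fun t => Real.negMulLog (f t)) :
    diffEntropy ν = (densityEntropy f : EReal) := by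
  rw [diffEntropy_eq_lintegral hf h0 hν, densityEntropy,
    integral_eq_lintegral_pos_part_sub_lintegral_neg_part hi, EReal.coe_sub,
    EReal.coe_ennreal_toReal, EReal.coe_ennreal_toReal]
  · exact hi.neg.lintegral_lt_top.ne
  · exact hi.lintegral_lt_top.ne

/-- The positive part is always finite, being dominated by `V f + exp (-V)`. Only the negative part
can diverge, and that would make the entropy `⊥`. -/
theorem integrable_negMulLog_of_diffEntropy_ne_bot (hf : Measurable f) (h0 : ∀ t, 0 ≤ f t)
    (hν : (ν : Measure ℝ) = volume.withDensity fun t => ENNReal.ofReal (f t))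
    (hE : Integrable fun t => Real.exp (-1 * V t))
    (hVf : Integrable fun t => V t * f t) (hbot : diffEntropy ν ≠ ⊥) :
    Integrable fun t => Real.negMulLog (f t) := by
  have hm : Measurable fun t => Real.negMulLog (f t) := Real.continuous_negMulLog.measurable.comp hf
  have hpos : ∫⁻ t, ENNReal.ofReal (Real.negMulLog (f t)) ≠ ⊤ := by
    refine ne_top_of_le_ne_top (hVf.add hE).lintegral_lt_top.ne
      (lintegral_mono fun t => ENNReal.ofReal_le_ofReal ?_)
    have h := negMulLog_le_of_pos (h0 t) (Real.exp_pos (-1 * V t))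
    rw [Real.log_exp] at h
    simp only [Pi.add_apply]
    linarith [h0 t]
  rw [diffEntropy_eq_lintegral hf h0 hν] at hbot
  have hneg : ∫⁻ t, ENNReal.ofReal (-Real.negMulLog (f t)) ≠ ⊤ := by
    intro h
    rw [h, EReal.coe_ennreal_top] at hbot
    exact hbot (EReal.sub_top _)
  refine ⟨hm.aestronglyMeasurable, ?_⟩
  rw [hasFiniteIntegral_iff_norm]
  have : ∀ t, ENNReal.ofReal ‖Real.negMulLog (f t)‖ = ENNReal.ofReal (Real.negMulLog (f t))
      + ENNReal.ofReal (-Real.negMulLog (f t)) := by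
    intro t
    rcases le_total 0 (Real.negMulLog (f t)) with h | h
    · rw [Real.norm_of_nonneg h, ENNReal.ofReal_of_nonpos (neg_nonpos.2 h), add_zero]
    · rw [Real.norm_of_nonpos h, ENNReal.ofReal_of_nonpos h, zero_add]
  simp_rw [this]
  rw [lintegral_add_left hm.ennreal_ofReal]
  exact ENNReal.add_lt_top.2 ⟨hpos.lt_top, hneg.lt_top⟩

theorem measurable_abs_rpow (p : ℝ) : Measurable fun t : ℝ => |t| ^ p := by fun_prop

/-- Together with its converse `IsAdmissible.exists_mem_entropyConstraint`, reduces suprema over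
measures to real-valued suprema over densities: measures of entropy `⊥` do not contribute. -/
theorem exists_isAdmissible_of_mem_entropyConstraint
    (hVp : Tendsto (fun x : ℝ => V x / |x| ^ p) (cocompact ℝ) atTop)
    (hV : IsOrlicz V) (hp : 1 < p) (hR : 0 < R) (hx : 0 ≤ x)
    (hν : ν ∈ entropyConstraint V p R x) (hbot : diffEntropy ν ≠ ⊥) :
    ∃ f, IsAdmissible V p R (x ^ p) f ∧ diffEntropy ν = (densityEntropy f : EReal) := by
  have hac : (ν : Measure ℝ) ≪ volume := by
    by_contra h
    exact hbot (if_neg h)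
  set f : ℝ → ℝ := fun t => ((ν : Measure ℝ).rnDeriv volume t).toReal with hfdef
  have hf : Measurable f := (Measure.measurable_rnDeriv _ _).ennreal_toReal
  have h0 : ∀ t, 0 ≤ f t := fun t => ENNReal.toReal_nonneg
  have hνf : (ν : Measure ℝ) = volume.withDensity fun t => ENNReal.ofReal (f t) := by
    rw [← Measure.withDensity_rnDeriv_eq _ _ hac]
    refine withDensity_congr_ae ?_
    filter_upwards [Measure.rnDeriv_lt_top (ν : Measure ℝ) volume] with t ht
    exact (ENNReal.ofReal_toReal ht.ne).symm
  have hVm := hV.continuous.measurable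
  obtain ⟨hν1, hν2⟩ := hν
  have hone : ∫⁻ t, ENNReal.ofReal (f t) = 1 := by
    have := measure_univ (μ := (ν : Measure ℝ))
    rwa [hνf, withDensity_apply _ MeasurableSet.univ, setLIntegral_univ] at this
  have hp0 : p ≠ 0 := by linarith
  have hmp : ∫⁻ t, ENNReal.ofReal (|t| ^ p * f t) = ENNReal.ofReal (x ^ p) := by
    rw [moment_of, hνf, lintegral_ofReal_withDensity hf h0 (measurable_abs_rpow p)] at hν1
    have := congrArg (· ^ p) hν1
    simp only [one_div] at this
    rwa [ENNReal.rpow_inv_rpow hp0, ENNReal.ofReal_rpow_of_nonneg hx (by linarith)] at this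
  rw [moment_of, hνf, lintegral_ofReal_withDensity hf h0 hVm] at hν2
  obtain ⟨iV, hVR⟩ := integrable_and_integral_eq_of_lintegral_ofReal (hVm.mul hf)
    (fun t => mul_nonneg (hV.nonneg t) (h0 t)) hR.le hν2
  obtain ⟨i1, -⟩ := integrable_and_integral_eq_of_lintegral_ofReal hf h0 zero_le_one
    (by rw [hone, ENNReal.ofReal_one])
  have hxp : 0 ≤ x ^ p := Real.rpow_nonneg hx p
  have hp0' : ∀ t, 0 ≤ |t| ^ p * f t := fun t => mul_nonneg (by positivity) (h0 t)
  have hpm : Measurable fun t => |t| ^ p * f t := (measurable_abs_rpow p).mul hf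
  obtain ⟨ip, -⟩ := integrable_and_integral_eq_of_lintegral_ofReal hpm hp0' hxp hmp.le
  have hE := integrable_exp_mul_of_neg hVp hV hp neg_one_lt_zero
  have ie := integrable_negMulLog_of_diffEntropy_ne_bot hf h0 hνf hE iV hbot
  refine ⟨f, ⟨hf, h0, i1, ?_, iV, hVR, ip, ?_, ie⟩, diffEntropy_eq_densityEntropy hf h0 hνf ie⟩
  · rw [integral_eq_lintegral_of_nonneg_ae (Eventually.of_forall h0) hf.aestronglyMeasurable, hone,
      ENNReal.toReal_one]
  · rw [integral_eq_lintegral_of_nonneg_ae (Eventually.of_forall hp0') hpm.aestronglyMeasurable,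
      hmp, ENNReal.toReal_ofReal hxp]

theorem IsAdmissible.exists_mem_entropyConstraint (hf : IsAdmissible V p R (x ^ p) f)
    (hV : IsOrlicz V) (hp : 1 < p) (hx : 0 ≤ x) :
    ∃ ν ∈ entropyConstraint V p R x, diffEntropy ν = (densityEntropy f : EReal) := by
  have hprob : IsProbabilityMeasure (volume.withDensity fun t => ENNReal.ofReal (f t)) := by
    constructor
    rw [withDensity_apply _ MeasurableSet.univ, setLIntegral_univ,
      ← ofReal_integral_eq_lintegral_ofReal hf.integrable (Eventually.of_forall hf.nonneg),
      hf.integral_eq_one, ENNReal.ofReal_one]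
  have hVm := hV.continuous.measurable
  refine ⟨⟨_, hprob⟩, ⟨?_, ?_⟩,
    diffEntropy_eq_densityEntropy hf.measurable hf.nonneg rfl hf.integrable_negMulLog⟩
  · change (∫⁻ t, ENNReal.ofReal (|t| ^ p)
      ∂(volume.withDensity fun t => ENNReal.ofReal (f t))) ^ (1 / p) = _
    rw [lintegral_ofReal_withDensity hf.measurable hf.nonneg (measurable_abs_rpow p),
      ← ofReal_integral_eq_lintegral_ofReal hf.integrable_rpow
        (Eventually.of_forall fun t => mul_nonneg (by positivity) (hf.nonneg t)),
      hf.integral_rpow, ENNReal.ofReal_rpow_of_nonneg (by positivity) (by positivity),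
      one_div, Real.rpow_rpow_inv hx (by linarith)]
  · change ∫⁻ t, ENNReal.ofReal (V t) ∂(volume.withDensity fun t => ENNReal.ofReal (f t)) ≤ _
    rw [lintegral_ofReal_withDensity hf.measurable hf.nonneg hVm,
      ← ofReal_integral_eq_lintegral_ofReal hf.integrable_V
        (Eventually.of_forall fun t => mul_nonneg (hV.nonneg t) (hf.nonneg t))]
    exact ENNReal.ofReal_le_ofReal hf.integral_V_le

end Bridge

/-! ### Compactness of sets of densities with entropy bounded below -/

/-- Uniform concavity of `-x log x` in Hellinger distance. With `m` the midpoint, use `log u ≤ u -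
1` at `u = √m / √c` for `c = a` and `c = b`, average, and complete the square in `√a + √b - 2 √m`.
-/
theorem avg_negMulLog_add_le {a b : ℝ} (ha : 0 ≤ a) (hb : 0 ≤ b) :
    (Real.negMulLog a + Real.negMulLog b) / 2 + (√a - √b) ^ 2 / 4
      ≤ Real.negMulLog ((a + b) / 2) := by
  set m := (a + b) / 2 with hm
  rcases (show 0 ≤ m by positivity).eq_or_lt with h0 | h0
  · have h1 : a = 0 := by linarith
    have h2 : b = 0 := by linarith
    simp [← h0, h1, h2]
  have key : ∀ c, 0 ≤ c → Real.negMulLog c ≤ -(c * Real.log m) - 2 * (c - √m * √c) := by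
    intro c hc
    rcases hc.eq_or_lt with rfl | hc
    · simp
    · have h := Real.log_le_sub_one_of_pos (div_pos (Real.sqrt_pos.2 h0) (Real.sqrt_pos.2 hc))
      rw [Real.log_div (Real.sqrt_pos.2 h0).ne' (Real.sqrt_pos.2 hc).ne',
        Real.log_sqrt h0.le, Real.log_sqrt hc.le] at h
      have h2 := mul_le_mul_of_nonneg_left h hc.le
      have h3 : c * (√m / √c - 1) = √m * √c - c := by
        have h4 : √c ≠ 0 := (Real.sqrt_pos.2 hc).ne'
        calc c * (√m / √c - 1) = √c * √c * (√m / √c) - c := by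
              rw [Real.mul_self_sqrt hc.le]
              ring
          _ = √m * √c - c := by
              rw [mul_assoc, mul_div_cancel₀ _ h4, mul_comm]
      unfold Real.negMulLog
      linarith
  have h1 := key a ha
  have h2 := key b hb
  have h3 : a = √a ^ 2 := (Real.sq_sqrt ha).symm
  have h4 : b = √b ^ 2 := (Real.sq_sqrt hb).symm
  have h5 : m = √m ^ 2 := (Real.sq_sqrt h0.le).symm
  have h6 : a * Real.log m + b * Real.log m = 2 * (m * Real.log m) := by
    rw [hm]
    ring
  have h7 : Real.negMulLog m = -(m * Real.log m) := by
    unfold Real.negMulLog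
    ring
  rw [h7]
  nlinarith [sq_nonneg (√a + √b - 2 * √m)]

/-- Fatou's lemma for Bochner integrals of nonnegative functions. -/
theorem integrable_and_integral_le_of_tendsto_ae {F : ℕ → ℝ → ℝ} {G : ℝ → ℝ} {c : ℕ → ℝ} {d : ℝ}
    (hG : Measurable G) (hF : ∀ k, Integrable (F k)) (h0 : ∀ k t, 0 ≤ F k t)
    (hlim : ∀ᵐ t, Tendsto (fun k => F k t) atTop (𝓝 (G t)))
    (hc : ∀ k, ∫ t, F k t ≤ c k) (hcd : Tendsto c atTop (𝓝 d)) :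
    Integrable G ∧ ∫ t, G t ≤ d := by
  have hG0 : 0 ≤ᵐ[volume] G := by
    filter_upwards [hlim] with t ht
    exact ge_of_tendsto' ht fun k => h0 k t
  have hd : 0 ≤ d := ge_of_tendsto' hcd fun k => (integral_nonneg (h0 k)).trans (hc k)
  have key : ∫⁻ t, ENNReal.ofReal (G t) ≤ ENNReal.ofReal d := by
    calc ∫⁻ t, ENNReal.ofReal (G t) = ∫⁻ t, liminf (fun k => ENNReal.ofReal (F k t)) atTop := by
          refine lintegral_congr_ae ?_
          filter_upwards [hlim] with t ht
          exact ((ENNReal.continuous_ofReal.tendsto _).comp ht).liminf_eq.symm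
      _ ≤ liminf (fun k => ∫⁻ t, ENNReal.ofReal (F k t)) atTop :=
          lintegral_liminf_le' fun k => (hF k).1.aemeasurable.ennreal_ofReal
      _ ≤ liminf (fun k => ENNReal.ofReal (c k)) atTop := by
          refine liminf_le_liminf (Eventually.of_forall fun k => ?_)
          rw [← ofReal_integral_eq_lintegral_ofReal (hF k) (Eventually.of_forall (h0 k))]
          exact ENNReal.ofReal_le_ofReal (hc k)
      _ = ENNReal.ofReal d := ((ENNReal.continuous_ofReal.tendsto _).comp hcd).liminf_eq
  refine ⟨⟨hG.aestronglyMeasurable, ?_⟩, ?_⟩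
  · rw [hasFiniteIntegral_iff_ofReal hG0]
    exact key.trans_lt ENNReal.ofReal_lt_top
  · rw [integral_eq_lintegral_of_nonneg_ae hG0 hG.aestronglyMeasurable]
    exact ENNReal.toReal_le_of_le_ofReal hd key

section Compactness

variable {V : ℝ → ℝ} {p R : ℝ}

theorem IsAdmissible.memLp_sqrt {y : ℝ} {f : ℝ → ℝ} (hf : IsAdmissible V p R y f) :
    MemLp (fun t => √(f t)) 2 volume := by
  rw [memLp_two_iff_integrable_sq hf.measurable.sqrt.aestronglyMeasurable]
  refine hf.integrable.congr (Eventually.of_forall fun t => ?_)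
  exact (Real.sq_sqrt (hf.nonneg t)).symm

theorem sq_norm_toLp_two {f : ℝ → ℝ} (hf : MemLp f 2 volume) :
    ‖hf.toLp‖ ^ 2 = ∫ t, f t ^ 2 := by
  rw [← real_inner_self_eq_norm_sq, L2.inner_def]
  refine integral_congr_ae ?_
  filter_upwards [hf.coeFn_toLp] with t ht
  rw [ht, real_inner_self_eq_norm_sq, Real.norm_eq_abs, sq_abs]

/-- The midpoint of two admissible densities, with a gain in entropy of the squared Hellinger
distance. -/
theorem IsAdmissible.midpoint {y₁ y₂ : ℝ} {f g : ℝ → ℝ} (hf : IsAdmissible V p R y₁ f)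
    (hg : IsAdmissible V p R y₂ g)
    (hVp : Tendsto (fun x : ℝ => V x / |x| ^ p) (cocompact ℝ) atTop)
    (hV : IsOrlicz V) (hp : 1 < p) :
    IsAdmissible V p R ((y₁ + y₂) / 2) (fun t => (f t + g t) / 2) ∧
    (densityEntropy f + densityEntropy g) / 2 + ‖hf.memLp_sqrt.toLp - hg.memLp_sqrt.toLp‖ ^ 2 / 4
      ≤ densityEntropy fun t => (f t + g t) / 2 := by
  have hmeas : Measurable fun t => (f t + g t) / 2 := (hf.measurable.add hg.measurable).div_const 2
  have h0 : ∀ t, 0 ≤ (f t + g t) / 2 := fun t => by linarith [hf.nonneg t, hg.nonneg t]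
  have iV : Integrable fun t => V t * ((f t + g t) / 2) :=
    ((hf.integrable_V.add hg.integrable_V).div_const 2).congr
      (Eventually.of_forall fun t => by simp only [Pi.add_apply]; ring)
  have hE := integrable_exp_mul_of_neg hVp hV hp neg_one_lt_zero
  have isq : Integrable fun t => (√(f t) - √(g t)) ^ 2 :=
    (hf.memLp_sqrt.sub hg.memLp_sqrt).integrable_sq
  have ilow : Integrable fun t => (Real.negMulLog (f t) + Real.negMulLog (g t)) / 2
      + (√(f t) - √(g t)) ^ 2 / 4 :=
    ((hf.integrable_negMulLog.add hg.integrable_negMulLog).div_const 2).add (isq.div_const 4)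
  have hlow := fun t => avg_negMulLog_add_le (hf.nonneg t) (hg.nonneg t)
  have ient : Integrable fun t => Real.negMulLog ((f t + g t) / 2) := by
    -- Bounded below by concavity and above by Gibbs' inequality against `exp (-V)`.
    refine integrable_of_le_of_le
      (Real.continuous_negMulLog.measurable.comp hmeas).aestronglyMeasurable
      (Eventually.of_forall hlow) (Eventually.of_forall fun t => ?_) ilow (iV.add hE)
    have h := negMulLog_le_of_pos (h0 t) (Real.exp_pos (-1 * V t))
    rw [Real.log_exp] at h
    simp only [Pi.add_apply]
    linarith [h0 t]
  refine ⟨⟨hmeas, h0, (hf.integrable.add hg.integrable).div_const 2, ?_, iV, ?_, ?_, ?_, ient⟩, ?_⟩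
  · rw [integral_div, integral_add hf.integrable hg.integrable, hf.integral_eq_one,
      hg.integral_eq_one]
    norm_num
  · have : ∀ t, V t * ((f t + g t) / 2) = (V t * f t + V t * g t) / 2 := fun t => by ring
    simp_rw [this]
    rw [integral_div, integral_add hf.integrable_V hg.integrable_V]
    linarith [hf.integral_V_le, hg.integral_V_le]
  · exact ((hf.integrable_rpow.add hg.integrable_rpow).div_const 2).congr
      (Eventually.of_forall fun t => by simp only [Pi.add_apply]; ring)
  · have : ∀ t, |t| ^ p * ((f t + g t) / 2) = (|t| ^ p * f t + |t| ^ p * g t) / 2 :=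
      fun t => by ring
    simp_rw [this]
    rw [integral_div, integral_add hf.integrable_rpow hg.integrable_rpow, hf.integral_rpow,
      hg.integral_rpow]
  · rw [← MemLp.toLp_sub, sq_norm_toLp_two]
    have h := integral_mono ilow ient hlow
    have hfg : Integrable fun t => (Real.negMulLog (f t) + Real.negMulLog (g t)) / 2 :=
      (hf.integrable_negMulLog.add hg.integrable_negMulLog).div_const 2
    rw [integral_add hfg (isq.div_const 4), integral_div, integral_div,
      integral_add hf.integrable_negMulLog hg.integrable_negMulLog] at h
    exact h

/-- An almost everywhere limit of admissible densities that preserves mass is admissible. -/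
theorem isAdmissible_of_tendsto_ae
    (hVp : Tendsto (fun x : ℝ => V x / |x| ^ p) (cocompact ℝ) atTop)
    (hV : IsOrlicz V) (hp : 1 < p) {y c : ℝ} {ys cs : ℕ → ℝ} {fs : ℕ → ℝ → ℝ} {f : ℝ → ℝ}
    (hfs : ∀ k, IsAdmissible V p R (ys k) (fs k)) (hcs : ∀ k, cs k ≤ densityEntropy (fs k))
    (hys : Tendsto ys atTop (𝓝 y)) (hc : Tendsto cs atTop (𝓝 c))
    (hlim : ∀ᵐ t, Tendsto (fun k => fs k t) atTop (𝓝 (f t)))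
    (hf : Measurable f) (h0 : ∀ t, 0 ≤ f t) (hone : ∫ t, f t = 1) :
    IsAdmissible V p R y f ∧ c ≤ densityEntropy f := by
  have hi : Integrable f := by
    by_contra h
    rw [integral_undef h] at hone
    exact zero_ne_one hone
  have hVm := hV.continuous.measurable
  have hpm := measurable_abs_rpow p
  obtain ⟨iV, hVR⟩ := integrable_and_integral_le_of_tendsto_ae (hVm.mul hf)
    (fun k => (hfs k).integrable_V) (fun k t => mul_nonneg (hV.nonneg t) ((hfs k).nonneg t))
    (by filter_upwards [hlim] with t ht using ht.const_mul _)
    (fun k => (hfs k).integral_V_le) tendsto_const_nhds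
  obtain ⟨ip, hpy⟩ := integrable_and_integral_le_of_tendsto_ae (hpm.mul hf)
    (fun k => (hfs k).integrable_rpow) (fun k t => mul_nonneg (by positivity) ((hfs k).nonneg t))
    (by filter_upwards [hlim] with t ht using ht.const_mul _)
    (fun k => (hfs k).integral_rpow.le) hys
  -- Fatou gives only `≤`. For the reverse, apply Fatou to the nonnegative weight `ε V + C - |t| ^
  -- p`, using that mass is preserved, and let `ε` be small.
  have hy : ∫ t, |t| ^ p * f t = y := by
    refine le_antisymm hpy ?_
    have hR : 0 ≤ R := (integral_nonneg fun t => mul_nonneg (hV.nonneg t) (h0 t)).trans hVR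
    refine le_of_forall_pos_le_add fun δ hδ => ?_
    set ε := δ / (R + 1) with hεdef
    have hε : 0 < ε := by positivity
    obtain ⟨C, -, hC⟩ := exists_rpow_le_mul_add hVp hV hp hε
    have heq : ∀ {g : ℝ → ℝ}, Integrable g → Integrable (fun t => V t * g t) →
        Integrable (fun t => |t| ^ p * g t) →
        Integrable (fun t => (ε * V t + C - |t| ^ p) * g t) ∧
        ∫ t, (ε * V t + C - |t| ^ p) * g t
          = ε * (∫ t, V t * g t) + C * (∫ t, g t) - ∫ t, |t| ^ p * g t := by
      intro g h1 h2 h3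
      have : ∀ t, (ε * V t + C - |t| ^ p) * g t = ε * (V t * g t) + C * g t - |t| ^ p * g t :=
        fun t => by ring
      simp_rw [this]
      have h4 : Integrable fun t => ε * (V t * g t) + C * g t :=
        (h2.const_mul ε).add (h1.const_mul C)
      refine ⟨h4.sub h3, ?_⟩
      rw [integral_sub h4 h3, ← integral_const_mul, ← integral_const_mul]
      congr 1
      exact integral_add (h2.const_mul ε) (h1.const_mul C)
    obtain ⟨-, h⟩ := integrable_and_integral_le_of_tendsto_ae
      (F := fun k t => (ε * V t + C - |t| ^ p) * fs k t)
      (G := fun t => (ε * V t + C - |t| ^ p) * f t)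
      (c := fun k => ε * R + C - ys k) (d := ε * R + C - y)
      (((measurable_const.mul hVm).add measurable_const |>.sub hpm).mul hf)
      (fun k => (heq (hfs k).integrable (hfs k).integrable_V (hfs k).integrable_rpow).1)
      (fun k t => mul_nonneg (sub_nonneg.2 (hC t)) ((hfs k).nonneg t))
      (by filter_upwards [hlim] with t ht using ht.const_mul _)
      (fun k => by
        rw [(heq (hfs k).integrable (hfs k).integrable_V (hfs k).integrable_rpow).2,
          (hfs k).integral_eq_one, (hfs k).integral_rpow]
        have := mul_le_mul_of_nonneg_left (hfs k).integral_V_le hε.le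
        linarith)
      (hys.const_sub _)
    rw [(heq hi iV ip).2, hone] at h
    have h1 : 0 ≤ ε * ∫ t, V t * f t :=
      mul_nonneg hε.le (integral_nonneg fun t => mul_nonneg (hV.nonneg t) (h0 t))
    have h2 : ε * R ≤ δ := by
      rw [hεdef, div_mul_eq_mul_div, div_le_iff₀ (by positivity)]
      nlinarith
    linarith
  have hE := integrable_exp_neg_rpow hp
  have hnm : Measurable fun t => Real.negMulLog (f t) := Real.continuous_negMulLog.measurable.comp hf
  -- Upper semicontinuity of entropy: this integrand is nonnegative by Gibbs' inequality against
  -- `exp (-|t| ^ p)`, and its other terms have convergent integrals, so Fatou bounds the entropy of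
  -- the limit from below.
  have ig : ∀ {y' : ℝ} {g : ℝ → ℝ}, IsAdmissible V p R y' g →
      Integrable (fun t => |t| ^ p * g t + Real.exp (-|t| ^ p) - g t - Real.negMulLog (g t)) ∧
      ∫ t, (|t| ^ p * g t + Real.exp (-|t| ^ p) - g t - Real.negMulLog (g t))
        = y' + (∫ t, Real.exp (-|t| ^ p)) - 1 - densityEntropy g := by
    intro y' g hg
    have h1 : Integrable fun t => |t| ^ p * g t + Real.exp (-|t| ^ p) := hg.integrable_rpow.add hE
    have h2 : Integrable fun t => |t| ^ p * g t + Real.exp (-|t| ^ p) - g t := h1.sub hg.integrable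
    refine ⟨h2.sub hg.integrable_negMulLog, ?_⟩
    rw [integral_sub h2 hg.integrable_negMulLog, densityEntropy, ← hg.integral_rpow,
      ← hg.integral_eq_one]
    congr 1
    refine (integral_sub h1 hg.integrable).trans ?_
    congr 1
    exact integral_add hg.integrable_rpow hE
  obtain ⟨iG, hG⟩ := integrable_and_integral_le_of_tendsto_ae
    (F := fun k t => |t| ^ p * fs k t + Real.exp (-|t| ^ p) - fs k t - Real.negMulLog (fs k t))
    (G := fun t => |t| ^ p * f t + Real.exp (-|t| ^ p) - f t - Real.negMulLog (f t))
    (c := fun k => ys k + (∫ t, Real.exp (-|t| ^ p)) - 1 - cs k)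
    (d := y + (∫ t, Real.exp (-|t| ^ p)) - 1 - c)
    ((((hpm.mul hf).add (Real.measurable_exp.comp hpm.neg)).sub hf).sub hnm)
    (fun k => (ig (hfs k)).1)
    (fun k t => by
      have h := negMulLog_le_of_pos ((hfs k).nonneg t) (Real.exp_pos (-|t| ^ p))
      rw [Real.log_exp] at h
      linarith)
    (by
      filter_upwards [hlim] with t ht
      exact (((ht.const_mul _).add tendsto_const_nhds).sub ht).sub
        ((Real.continuous_negMulLog.tendsto _).comp ht))
    (fun k => by
      rw [(ig (hfs k)).2]
      linarith [hcs k])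
    (((hys.add_const _).sub_const 1).sub hc)
  have ient : Integrable fun t => Real.negMulLog (f t) := by
    refine (((ip.add hE).sub hi).sub iG).congr (Eventually.of_forall fun t => ?_)
    simp only [Pi.add_apply, Pi.sub_apply, Pi.mul_apply]
    ring
  have hadm : IsAdmissible V p R y f := ⟨hf, h0, hi, hone, iV, hVR, ip, hy, ient⟩
  refine ⟨hadm, ?_⟩
  rw [(ig hadm).2] at hG
  linarith

/-- Take near-maximisers of entropy over shrinking windows around `y`. Midpoints stay in the larger
window, so their entropy cannot exceed its supremum; the Hellinger gain is therefore small and the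
square roots are Cauchy in `L²`. Varying `y'` gives closed sublevel sets, fixing `y' = y` gives an
attained maximum. -/
theorem exists_isAdmissible_of_forall_pos
    (hVp : Tendsto (fun x : ℝ => V x / |x| ^ p) (cocompact ℝ) atTop)
    (hV : IsOrlicz V) (hp : 1 < p) {y c : ℝ}
    (h : ∀ ε > 0, ∃ y' f, |y' - y| ≤ ε ∧ IsAdmissible V p R y' f ∧ c - ε ≤ densityEntropy f) :
    ∃ f, IsAdmissible V p R y f ∧ c ≤ densityEntropy f := by
  set δ : ℕ → ℝ := fun k => 1 / ((k : ℝ) + 1) with hδdef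
  have hδ : ∀ k, 0 < δ k := fun k => by positivity
  have hδ0 : Tendsto δ atTop (𝓝 0) := tendsto_one_div_add_atTop_nhds_zero_nat
  have hδanti : Antitone δ := fun j k hjk => by
    apply one_div_le_one_div_of_le (by positivity)
    exact_mod_cast Nat.succ_le_succ hjk
  set S : ℕ → Set ℝ := fun k => {e | ∃ y' f, |y' - y| ≤ δ k ∧ IsAdmissible V p R y' f ∧
    e = densityEntropy f} with hS
  have hbdd : ∀ k, BddAbove (S k) := fun k => by
    refine ⟨-gibbsDual V R (-1), ?_⟩
    rintro e ⟨y', f, -, hf, rfl⟩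
    exact hf.densityEntropy_le hVp hV hp neg_one_lt_zero
  have hne : ∀ k, ∃ e ∈ S k, c - δ k ≤ e := fun k => by
    obtain ⟨y', f, h1, h2, h3⟩ := h (δ k) (hδ k)
    exact ⟨_, ⟨y', f, h1, h2, rfl⟩, h3⟩
  set s : ℕ → ℝ := fun k => sSup (S k) with hs
  have hsc : ∀ k, c - δ k ≤ s k := fun k => by
    obtain ⟨e, he, hce⟩ := hne k
    exact hce.trans (le_csSup (hbdd k) he)
  have hanti : Antitone s := fun j k hjk => by
    refine csSup_le_csSup (hbdd j) ((hne k).imp fun _ h => h.1) ?_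
    rintro e ⟨y', f, h1, h2⟩
    exact ⟨y', f, h1.trans (hδanti hjk), h2⟩
  have hsb : BddBelow (Set.range s) := by
    refine ⟨c - δ 0, ?_⟩
    rintro _ ⟨k, rfl⟩
    exact (sub_le_sub_left (hδanti (Nat.zero_le k)) c).trans (hsc k)
  -- The window suprema decrease to `s'`; the gaps `s j - s'` are what the Hellinger distances are
  -- measured against.
  set s' := ⨅ k, s k
  have hs' : Tendsto s atTop (𝓝 s') := tendsto_atTop_ciInf hanti hsb
  have hcs' : c ≤ s' := le_of_tendsto_of_tendsto' (by simpa using hδ0.const_sub c) hs' hsc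
  have hex : ∀ k, ∃ y' f, |y' - y| ≤ δ k ∧ IsAdmissible V p R y' f ∧
      s k - δ k ≤ densityEntropy f := fun k => by
    obtain ⟨e, ⟨y', f, h1, h2, rfl⟩, h3⟩ := exists_lt_of_lt_csSup
      ((hne k).imp fun _ h => h.1) (sub_lt_self (s k) (hδ k))
    exact ⟨y', f, h1, h2, h3.le⟩
  choose ys fs hys hfs hent using hex
  set u : ℕ → Lp ℝ 2 volume := fun k => (hfs k).memLp_sqrt.toLp with hu
  have hdist : ∀ j k, j ≤ k → dist (u j) (u k) ≤ √(4 * ((s j - s') + δ j)) := by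
    intro j k hjk
    obtain ⟨h1, h2⟩ := (hfs j).midpoint (hfs k) hVp hV hp
    have h3 : densityEntropy (fun t => (fs j t + fs k t) / 2) ≤ s j := by
      refine le_csSup (hbdd j) ⟨_, _, ?_, h1, rfl⟩
      have h4 := abs_le.1 (hys j)
      have h5 := abs_le.1 ((hys k).trans (hδanti hjk))
      rw [abs_le]
      constructor <;> linarith
    rw [dist_eq_norm]
    refine Real.le_sqrt_of_sq_le ?_
    have h4 := hent j
    have h5 := hent k
    have h6 : s' ≤ s k := ciInf_le hsb k
    have h7 : s' ≤ s j := ciInf_le hsb j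
    have h8 := hδanti hjk
    have h9 : ‖u j - u k‖ ^ 2 / 4 ≤ s j - (densityEntropy (fs j) + densityEntropy (fs k)) / 2 := by
      linarith
    linarith
  have hb0 : Tendsto (fun j => √(4 * ((s j - s') + δ j))) atTop (𝓝 0) := by
    have := (((hs'.sub_const s').add hδ0).const_mul 4).sqrt
    simpa using this
  obtain ⟨ψ, hψ⟩ := cauchySeq_tendsto_of_complete (cauchySeq_of_le_tendsto_0' _ hdist hb0)
  obtain ⟨ns, hns, hae⟩ := (tendstoInMeasure_of_tendsto_Lp hψ).exists_seq_tendsto_ae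
  have hψm : Measurable ψ := (Lp.stronglyMeasurable ψ).measurable
  -- Norm convergence in `L²` is what prevents loss of mass in the limit.
  have hnorm : ∫ t, ψ t ^ 2 = 1 := by
    have h1 : ∀ k, ‖u k‖ ^ 2 = 1 := fun k => by
      rw [hu, sq_norm_toLp_two, ← (hfs k).integral_eq_one]
      exact integral_congr_ae (Eventually.of_forall fun t => Real.sq_sqrt ((hfs k).nonneg t))
    have h2 : ‖ψ‖ ^ 2 = 1 := tendsto_nhds_unique (hψ.norm.pow 2)
      (by simp_rw [h1]; exact tendsto_const_nhds)
    have h3 := sq_norm_toLp_two (Lp.memLp ψ)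
    rw [Lp.toLp_coeFn] at h3
    rw [← h3, h2]
  have hlim : ∀ᵐ t, Tendsto (fun k => fs (ns k) t) atTop (𝓝 (ψ t ^ 2)) := by
    have h1 : ∀ᵐ t, ∀ k, u k t = √(fs k t) :=
      ae_all_iff.2 fun k => (hfs k).memLp_sqrt.coeFn_toLp
    filter_upwards [hae, h1] with t ht ht1
    refine (ht.pow 2).congr fun k => ?_
    rw [ht1, Real.sq_sqrt ((hfs (ns k)).nonneg t)]
  have hyt : Tendsto ys atTop (𝓝 y) := by
    rw [tendsto_iff_dist_tendsto_zero]
    exact squeeze_zero (fun _ => dist_nonneg) hys hδ0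
  obtain ⟨h1, h2⟩ := isAdmissible_of_tendsto_ae hVp hV hp (fun k => hfs (ns k))
    (fun k => hent (ns k)) (hyt.comp hns.tendsto_atTop)
    ((hs'.sub hδ0).comp hns.tendsto_atTop) hlim (hψm.pow_const 2) (fun t => sq_nonneg _) hnorm
  exact ⟨_, h1, by linarith⟩

end Compactness

/-! ### Volume of a set and the entropy of its averaged marginal -/

/-- The average of the `n` marginals of the uniform distribution on `A ⊆ ℝⁿ`. -/
noncomputable def averageMarginal {n : ℕ} (A : Set (Fin n → ℝ)) : Measure ℝ :=
  ((n : ℝ≥0∞) * volume A)⁻¹ • ∑ k, (volume.restrict A).map fun x => x k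

section AverageMarginal

variable {n : ℕ} {A : Set (Fin n → ℝ)}

theorem integrable_comp_eval_of_averageMarginal (hn : n ≠ 0) (hA : volume A ≠ ⊤)
    (hA0 : volume A ≠ 0) {φ : ℝ → ℝ}
    (hφ : Measurable φ) (hi : Integrable φ (averageMarginal A)) (k : Fin n) :
    IntegrableOn (fun x => φ (x k)) A := by
  rw [averageMarginal, integrable_smul_measure
    (ENNReal.inv_ne_zero.2 (ENNReal.mul_ne_top (ENNReal.natCast_ne_top n) hA)),
    integrable_finsetSum_measure] at hi
  · have := hi k (Finset.mem_univ k)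
    rwa [integrable_map_measure hφ.aestronglyMeasurable (measurable_pi_apply k).aemeasurable]
      at this
  · exact ENNReal.inv_ne_top.2 (mul_ne_zero (Nat.cast_ne_zero.2 hn) hA0)

theorem integral_averageMarginal (hn : n ≠ 0) (hA : volume A ≠ ⊤) (hA0 : volume A ≠ 0) {φ : ℝ → ℝ}
    (hφ : Measurable φ) (hi : Integrable φ (averageMarginal A)) :
    (n * (volume A).toReal) * ∫ t, φ t ∂(averageMarginal A) = ∫ x in A, ∑ k, φ (x k) := by
  have hv : (volume A).toReal ≠ 0 := (ENNReal.toReal_pos hA0 hA).ne'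
  have hk := integrable_comp_eval_of_averageMarginal hn hA hA0 hφ hi
  have hn' : (n : ℝ) ≠ 0 := Nat.cast_ne_zero.2 hn
  rw [averageMarginal, integral_smul_measure, integral_finsetSum_measure,
    integral_finsetSum _ fun k _ => hk k]
  · rw [ENNReal.toReal_inv, ENNReal.toReal_mul, ENNReal.toReal_natCast, smul_eq_mul,
      mul_inv_cancel_left₀ (mul_ne_zero hn' hv)]
    exact Finset.sum_congr rfl fun k _ =>
      integral_map (measurable_pi_apply k).aemeasurable hφ.aestronglyMeasurable
  · intro k _
    rw [integrable_map_measure hφ.aestronglyMeasurable (measurable_pi_apply k).aemeasurable]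
    exact hk k

/-- Each single marginal is absolutely continuous with respect to the average of all of them. -/
theorem ae_comp_eval_of_averageMarginal {P : ℝ → Prop} (hA : volume A ≠ ⊤)
    (h : ∀ᵐ t ∂(averageMarginal A), P t) : ∀ᵐ x ∂(volume.restrict A), ∀ k, P (x k) := by
  refine ae_all_iff.2 fun k => ?_
  have h0 : ((n : ℝ≥0∞) * volume A)⁻¹ ≠ 0 :=
    ENNReal.inv_ne_zero.2 (ENNReal.mul_ne_top (ENNReal.natCast_ne_top n) hA)
  have h1 : (volume.restrict A).map (fun x => x k) ≪ averageMarginal A := by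
    refine Measure.AbsolutelyContinuous.trans ?_ (Measure.absolutelyContinuous_smul h0)
    refine Measure.absolutelyContinuous_of_le ?_
    exact Finset.single_le_sum (f := fun k => (volume.restrict A).map fun x : Fin n → ℝ => x k)
      (fun _ _ => Measure.zero_le _) (Finset.mem_univ k)
  exact ae_of_ae_map (measurable_pi_apply k).aemeasurable (h1.ae_le h)

theorem averageMarginal_univ (hn : n ≠ 0) (hA : volume A ≠ ⊤) (hA0 : volume A ≠ 0) :
    averageMarginal A Set.univ = 1 := by
  rw [averageMarginal, Measure.smul_apply, Measure.finsetSum_apply, smul_eq_mul]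
  have : ∀ k : Fin n, (volume.restrict A).map (fun x => x k) Set.univ = volume A := fun k => by
    rw [Measure.map_apply (measurable_pi_apply k) MeasurableSet.univ, Set.preimage_univ,
      Measure.restrict_apply_univ]
  simp_rw [this]
  rw [Finset.sum_const, Finset.card_univ, Fintype.card_fin, nsmul_eq_mul]
  exact ENNReal.inv_mul_cancel (mul_ne_zero (Nat.cast_ne_zero.2 hn) hA0)
    (ENNReal.mul_ne_top (ENNReal.natCast_ne_top n) hA)

/-- Fixing one coordinate leaves at most `(2 L) ^ (n - 1)` of volume in the box. The constant is
crude and depends on `n`, but a bounded, compactly supported density settles all integrability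
questions. -/
theorem averageMarginal_apply_le (hn : n ≠ 0) (hA : volume A ≠ ⊤) (hA0 : volume A ≠ 0) {L : ℝ}
    (hL : 0 ≤ L) (hbox : ∀ x ∈ A, ∀ k, x k ∈ Set.Icc (-L) L) :
    ∃ C : ℝ, 0 ≤ C ∧ ∀ S, MeasurableSet S →
      averageMarginal A S ≤ ENNReal.ofReal C * volume.restrict (Set.Icc (-L) L) S := by
  refine ⟨(2 * L) ^ (n - 1) / (volume A).toReal, by positivity, fun S hS => ?_⟩
  have hk : ∀ k : Fin n, (volume.restrict A).map (fun x => x k) S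
      ≤ ENNReal.ofReal ((2 * L) ^ (n - 1)) * volume.restrict (Set.Icc (-L) L) S := fun k => by
    rw [Measure.map_apply (measurable_pi_apply k) hS,
      Measure.restrict_apply (measurable_pi_apply k hS), Measure.restrict_apply hS]
    have hsub : (fun x : Fin n → ℝ => x k) ⁻¹' S ∩ A ⊆
        Set.univ.pi (Function.update (fun _ => Set.Icc (-L) L) k (S ∩ Set.Icc (-L) L)) := by
      rintro x ⟨hx, hxA⟩ j -
      rcases eq_or_ne j k with rfl | hj
      · rw [Function.update_self]
        exact ⟨hx, hbox x hxA j⟩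
      · rw [Function.update_of_ne hj]
        exact hbox x hxA j
    refine (measure_mono hsub).trans (le_of_eq ?_)
    rw [volume_pi_pi, ← Finset.mul_prod_erase _ _ (Finset.mem_univ k), Function.update_self,
      Finset.prod_congr rfl (g := fun _ => ENNReal.ofReal (2 * L)), Finset.prod_const,
      Finset.card_erase_of_mem (Finset.mem_univ k), Finset.card_univ, Fintype.card_fin,
      ENNReal.ofReal_pow (by positivity), mul_comm]
    intro j hj
    rw [Function.update_of_ne (Finset.ne_of_mem_erase hj), Real.volume_Icc]
    congr 1
    ring
  have hv := ENNReal.toReal_pos hA0 hA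
  rw [averageMarginal, Measure.smul_apply, Measure.finsetSum_apply, smul_eq_mul]
  calc ((n : ℝ≥0∞) * volume A)⁻¹ * ∑ k : Fin n, (volume.restrict A).map (fun x => x k) S
      ≤ ((n : ℝ≥0∞) * volume A)⁻¹ * ∑ _k : Fin n,
          (ENNReal.ofReal ((2 * L) ^ (n - 1)) * volume.restrict (Set.Icc (-L) L) S) := by
        gcongr with k
        exact hk k
    _ = _ := by
        rw [Finset.sum_const, Finset.card_univ, Fintype.card_fin, nsmul_eq_mul,
          ENNReal.mul_inv (Or.inl (Nat.cast_ne_zero.2 hn)) (Or.inl (ENNReal.natCast_ne_top n)),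
          ENNReal.ofReal_div_of_pos hv, ENNReal.ofReal_toReal hA, div_eq_mul_inv]
        rw [mul_comm (n : ℝ≥0∞)⁻¹, mul_assoc, ← mul_assoc (n : ℝ≥0∞)⁻¹,
          ENNReal.inv_mul_cancel (Nat.cast_ne_zero.2 hn) (ENNReal.natCast_ne_top n), one_mul]
        ring

end AverageMarginal

/-- A measure dominated by a multiple of Lebesgue measure on a measurable set has a bounded
density supported on this set. -/
theorem exists_density_of_le_restrict {ν : Measure ℝ} [IsFiniteMeasure ν] {I : Set ℝ}
    (hI : MeasurableSet I) {C : ℝ} (hC : 0 ≤ C)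
    (h : ∀ S, MeasurableSet S → ν S ≤ ENNReal.ofReal C * volume.restrict I S) :
    ∃ f : ℝ → ℝ, Measurable f ∧ (∀ t, 0 ≤ f t) ∧ (∀ t, f t ≤ C) ∧ (∀ t, t ∉ I → f t = 0) ∧
      ν = volume.withDensity fun t => ENNReal.ofReal (f t) := by
  have hac : ν ≪ volume.restrict I := Measure.AbsolutelyContinuous.mk fun S hS h0 => by
    have := h S hS
    rw [h0, mul_zero] at this
    exact le_antisymm this zero_le
  set g := ν.rnDeriv (volume.restrict I) with hg
  have hgm : Measurable g := Measure.measurable_rnDeriv _ _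
  have hgC : ∀ᵐ t ∂(volume.restrict I), g t ≤ ENNReal.ofReal C := by
    refine ae_le_of_forall_setLIntegral_le_of_sigmaFinite hgm fun S hS _ => ?_
    rw [Measure.setLIntegral_rnDeriv hac, setLIntegral_const]
    exact h S hS
  -- Truncation and the indicator make the bounds hold everywhere instead of almost everywhere.
  refine ⟨I.indicator fun t => min (g t).toReal C, ?_, ?_, ?_, ?_, ?_⟩
  · exact (hgm.ennreal_toReal.min measurable_const).indicator hI
  · exact Set.indicator_nonneg fun t _ => le_min ENNReal.toReal_nonneg hC
  · exact fun t => Set.indicator_apply_le' (fun _ => min_le_right _ _) fun _ => hC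
  · exact fun t ht => Set.indicator_of_notMem ht _
  · have : (fun t => ENNReal.ofReal (I.indicator (fun t => min (g t).toReal C) t))
        = I.indicator fun t => ENNReal.ofReal (min (g t).toReal C) := by
      ext t
      by_cases ht : t ∈ I <;> simp [ht]
    rw [this, withDensity_indicator hI]
    refine (Measure.withDensity_rnDeriv_eq _ _ hac).symm.trans (withDensity_congr_ae ?_)
    filter_upwards [hgC] with t ht
    have h1 : (g t).toReal ≤ C := ENNReal.toReal_le_of_le_ofReal hC ht
    rw [min_eq_left h1, ENNReal.ofReal_toReal (ne_top_of_le_ne_top ENNReal.ofReal_ne_top ht)]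

/-! ### Integration against densities and product densities -/

section DensityIntegral

variable {f : ℝ → ℝ}

theorem integrable_withDensity_ofReal_iff (hf : Measurable f) (h0 : ∀ t, 0 ≤ f t) {φ : ℝ → ℝ} :
    Integrable φ (volume.withDensity fun t => ENNReal.ofReal (f t)) ↔
      Integrable fun t => φ t * f t := by
  rw [integrable_withDensity_iff hf.ennreal_ofReal (Eventually.of_forall fun _ => by simp)]
  simp_rw [ENNReal.toReal_ofReal (h0 _)]

theorem integral_withDensity_ofReal (hf : Measurable f) (h0 : ∀ t, 0 ≤ f t) (φ : ℝ → ℝ) :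
    ∫ t, φ t ∂(volume.withDensity fun t => ENNReal.ofReal (f t)) = ∫ t, φ t * f t := by
  rw [integral_withDensity_eq_integral_toReal_smul hf.ennreal_ofReal
    (Eventually.of_forall fun _ => by simp)]
  simp_rw [ENNReal.toReal_ofReal (h0 _), smul_eq_mul, mul_comm]

theorem integrable_prod_density {n : ℕ} (hi : Integrable f) :
    Integrable fun x : Fin n → ℝ => ∏ k, f (x k) :=
  Integrable.fintype_prod fun _ => hi

theorem integral_prod_density {n : ℕ} (hone : ∫ t, f t = 1) :
    ∫ x : Fin n → ℝ, ∏ k, f (x k) = 1 := by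
  rw [integral_fintype_prod_volume_eq_pow, hone, one_pow]

end DensityIntegral

/-! ### Entropy upper bound for volumes inside the Orlicz ball -/

section Ball

variable {V : ℝ → ℝ} {p R : ℝ} {n : ℕ}

theorem measurableSet_orliczBall (hV : IsOrlicz V) : MeasurableSet (orliczBall V R n) := by
  have := hV.continuous.measurable
  exact measurableSet_le (by fun_prop) measurable_const

theorem exists_orliczBall_subset_box
    (hVp : Tendsto (fun x : ℝ => V x / |x| ^ p) (cocompact ℝ) atTop)
    (hV : IsOrlicz V) (hp : 1 < p) (hR : 0 < R) (n : ℕ) :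
    ∃ L : ℝ, 0 ≤ L ∧ ∀ x ∈ orliczBall V R n, ∀ k, x k ∈ Set.Icc (-L) L := by
  obtain ⟨C, hC0, hC⟩ := exists_rpow_le_mul_add hVp hV hp one_pos
  refine ⟨1 + R * n + C, by positivity, fun x hx k => ?_⟩
  have h1 : V (x k) ≤ R * n :=
    (Finset.single_le_sum (fun j _ => hV.nonneg (x j)) (Finset.mem_univ k)).trans hx
  rw [Set.mem_Icc, ← abs_le]
  linarith [abs_le_one_add_rpow hp (x k), hC (x k)]

/-- Here `f` is the density of the averaged marginal. The constraints on `A` are sums over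
coordinates, so they pass to `f`. The entropy bound is Gibbs' inequality between the uniform density
`1 / v` on `A` and the product of the `f (x k)`: the integral over `A` of `log (v ∏ f)` equals `v
(log v - n h(f))` and is at most `v ∫_A ∏ f - v ≤ 0`. -/
theorem log_volume_le_densityEntropy
    (hVp : Tendsto (fun x : ℝ => V x / |x| ^ p) (cocompact ℝ) atTop)
    (hV : IsOrlicz V) (hp : 1 < p) (hR : 0 < R) (hn : n ≠ 0) {A : Set (Fin n → ℝ)}
    (hAm : MeasurableSet A) (hAb : A ⊆ orliczBall V R n) (hA0 : volume A ≠ 0) {a b : ℝ}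
    (hab : ∀ x ∈ A, (∑ k, |x k| ^ p) ∈ Set.Icc (n * a) (n * b)) :
    volume A ≠ ⊤ ∧ ∃ y ∈ Set.Icc a b, ∃ f, IsAdmissible V p R y f ∧
      Real.log (volume A).toReal ≤ n * densityEntropy f := by
  obtain ⟨L, hL, hbox⟩ := exists_orliczBall_subset_box hVp hV hp hR n
  have hA : volume A ≠ ⊤ := by
    refine ne_top_of_le_ne_top ?_ (measure_mono (t := Set.univ.pi fun _ => Set.Icc (-L) L)
      fun x hx k _ => hbox x (hAb hx) k)
    rw [volume_pi_pi]
    exact ENNReal.prod_ne_top fun _ _ => by simp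
  refine ⟨hA, ?_⟩
  set v := (volume A).toReal with hv
  have hv0 : 0 < v := ENNReal.toReal_pos hA0 hA
  have hn0 : (0 : ℝ) < n := Nat.cast_pos.2 (Nat.pos_of_ne_zero hn)
  have hprob : IsProbabilityMeasure (averageMarginal A) := ⟨averageMarginal_univ hn hA hA0⟩
  obtain ⟨C, hC0, hC⟩ := averageMarginal_apply_le hn hA hA0 hL fun x hx => hbox x (hAb hx)
  obtain ⟨f, hf, h0, hfC, hfI, hν⟩ := exists_density_of_le_restrict measurableSet_Icc hC0 hC
  have hint : ∀ φ : ℝ → ℝ, Measurable φ → (∃ B, ∀ t ∈ Set.Icc (-L) L, |φ t| ≤ B) →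
      (∀ t, t ∉ Set.Icc (-L) L → φ t = 0) → Integrable φ := by
    rintro φ hφ ⟨B, hB⟩ hφ0
    rw [← integrableOn_iff_integrable_of_support_subset (s := Set.Icc (-L) L)
      fun t ht => by_contra fun h => ht (hφ0 t h)]
    exact Measure.integrableOn_of_bounded (M := B) (by simp) hφ.aestronglyMeasurable
      ((ae_restrict_iff' measurableSet_Icc).2 (Eventually.of_forall hB))
  have hcont : ∀ φ : ℝ → ℝ, Continuous φ → Integrable fun t => φ t * f t := fun φ hφ => by
    obtain ⟨B, hB⟩ := isCompact_Icc.exists_bound_of_continuousOn (hφ.continuousOn (s := Set.Icc (-L) L))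
    refine hint _ (hφ.measurable.mul hf) ⟨B * C, fun t ht => ?_⟩ fun t ht => by simp [hfI t ht]
    rw [abs_mul, abs_of_nonneg (h0 t)]
    exact mul_le_mul (hB t ht) (hfC t) (h0 t) ((norm_nonneg _).trans (hB t ht))
  have hpc : Continuous fun t : ℝ => |t| ^ p :=
    continuous_abs.rpow_const fun _ => Or.inr (by linarith)
  have hi : Integrable f := by simpa using hcont (fun _ => 1) continuous_const
  have ient : Integrable fun t => Real.negMulLog (f t) := by
    obtain ⟨B, hB⟩ := isCompact_Icc.exists_bound_of_continuousOn
      (Real.continuous_negMulLog.continuousOn (s := Set.Icc 0 C))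
    exact hint _ (Real.continuous_negMulLog.measurable.comp hf)
      ⟨B, fun t _ => hB _ ⟨h0 t, hfC t⟩⟩ fun t ht => by simp [hfI t ht]
  have hone : ∫ t, f t = 1 := by
    have h1 := integral_withDensity_ofReal hf h0 fun _ => 1
    rw [← hν] at h1
    simpa using h1.symm
  have havg : ∀ φ : ℝ → ℝ, Measurable φ → Integrable (fun t => φ t * f t) →
      (∀ k, IntegrableOn (fun x => φ (x k)) A) ∧
      n * v * ∫ t, φ t * f t = ∫ x in A, ∑ k, φ (x k) := fun φ hφ hφi => by
    rw [← integrable_withDensity_ofReal_iff hf h0, ← hν] at hφi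
    rw [← integral_withDensity_ofReal hf h0, ← hν]
    exact ⟨integrable_comp_eval_of_averageMarginal hn hA hA0 hφ hφi,
      integral_averageMarginal hn hA hA0 hφ hφi⟩
  have hconst : ∀ c : ℝ, ∫ _ in A, c = v * c := fun c => by
    rw [setIntegral_const, smul_eq_mul, Measure.real]
  have hconsti : ∀ c : ℝ, IntegrableOn (fun _ => c) A := fun c =>
    integrableOn_const hA
  obtain ⟨iV, hV1⟩ := havg V hV.continuous.measurable (hcont V hV.continuous)
  obtain ⟨ip, hp1⟩ := havg _ hpc.measurable (hcont _ hpc)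
  have hVR : ∫ t, V t * f t ≤ R := by
    have h1 : ∫ x in A, ∑ k, V (x k) ≤ ∫ _ in A, R * n :=
      setIntegral_mono_on (integrable_finsetSum _ fun k _ => iV k) (hconsti _) hAm
        fun x hx => hAb hx
    rw [← hV1, hconst] at h1
    refine le_of_mul_le_mul_left (h1.trans (le_of_eq ?_)) (mul_pos hn0 hv0)
    ring
  refine ⟨∫ t, |t| ^ p * f t, ⟨?_, ?_⟩, f, ⟨hf, h0, hi, hone, hcont V hV.continuous, hVR,
    hcont _ hpc, rfl, ient⟩, ?_⟩
  · have h1 : ∫ _ in A, n * a ≤ ∫ x in A, ∑ k, |x k| ^ p :=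
      setIntegral_mono_on (hconsti _) (integrable_finsetSum _ fun k _ => ip k) hAm
        fun x hx => (hab x hx).1
    rw [← hp1, hconst] at h1
    refine le_of_mul_le_mul_left (le_of_eq_of_le ?_ h1) (mul_pos hn0 hv0)
    ring
  · have h1 : ∫ x in A, ∑ k, |x k| ^ p ≤ ∫ _ in A, n * b :=
      setIntegral_mono_on (integrable_finsetSum _ fun k _ => ip k) (hconsti _) hAm
        fun x hx => (hab x hx).2
    rw [← hp1, hconst] at h1
    refine le_of_mul_le_mul_left (h1.trans (le_of_eq ?_)) (mul_pos hn0 hv0)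
    ring
  · have hlog : ∀ t, Real.log (f t) * f t = -Real.negMulLog (f t) := fun t => by
      unfold Real.negMulLog
      ring
    obtain ⟨il, hl1⟩ := havg (fun t => Real.log (f t)) (by fun_prop) (by
      simp_rw [hlog]
      exact ient.neg)
    simp_rw [hlog] at hl1
    rw [integral_neg] at hl1
    have hpos : ∀ᵐ t ∂(averageMarginal A), 0 < f t := by
      rw [hν, ae_withDensity_iff hf.ennreal_ofReal]
      exact Eventually.of_forall fun t ht => ENNReal.ofReal_pos.1 (pos_iff_ne_zero.2 ht)
    have hposA := ae_comp_eval_of_averageMarginal hA hpos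
    have hprodi := integrable_prod_density (n := n) hi
    have h1 : ∫ x in A, (∑ k, Real.log (f (x k)) + Real.log v)
        ≤ ∫ x in A, (v * ∏ k, f (x k) - 1) := by
      refine integral_mono_ae ((integrable_finsetSum _ fun k _ => il k).add (hconsti _))
        ((hprodi.integrableOn.const_mul v).sub (hconsti 1)) ?_
      filter_upwards [hposA] with x hx
      have h2 : 0 < ∏ k, f (x k) := Finset.prod_pos fun k _ => hx k
      have h3 := Real.log_le_sub_one_of_pos (mul_pos hv0 h2)
      rw [Real.log_mul hv0.ne' h2.ne', Real.log_prod fun k _ => (hx k).ne'] at h3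
      linarith
    have h2 : ∫ x in A, ∏ k, f (x k) ≤ 1 := by
      rw [← integral_prod_density (n := n) hone]
      exact setIntegral_le_integral hprodi
        (Eventually.of_forall fun x => Finset.prod_nonneg fun k _ => h0 _)
    rw [integral_add (integrable_finsetSum _ fun k _ => il k) (hconsti _), ← hl1, hconst,
      integral_sub (hprodi.integrableOn.const_mul v) (hconsti 1), hconst,
      integral_const_mul] at h1
    have h3 : v * (Real.log v - n * densityEntropy f) ≤ 0 := by
      have h4 := mul_le_mul_of_nonneg_left h2 hv0.le
      unfold densityEntropy
      linarith
    have h4 := nonpos_of_mul_nonpos_right h3 hv0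
    linarith

end Ball

/-! ### Lower bounds for volumes by the law of large numbers -/

section ProductDensity

variable {f : ℝ → ℝ}

theorem pi_withDensity_ofReal (h0 : ∀ t, 0 ≤ f t) (hi : Integrable f) (n : ℕ)
    [IsProbabilityMeasure (volume.withDensity fun t => ENNReal.ofReal (f t))] :
    Measure.pi (fun _ : Fin n => volume.withDensity fun t => ENNReal.ofReal (f t))
      = volume.withDensity fun x : Fin n → ℝ => ENNReal.ofReal (∏ k, f (x k)) := by
  refine Measure.pi_eq fun s hs => ?_
  rw [withDensity_apply _ (MeasurableSet.univ_pi hs), volume_pi, Measure.restrict_pi_pi,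
    ← ofReal_integral_eq_lintegral_ofReal (Integrable.fintype_prod fun _ => hi.restrict)
      (Eventually.of_forall fun x => Finset.prod_nonneg fun k _ => h0 _),
    integral_fintype_prod_eq_prod (fun _ : Fin n => f),
    ENNReal.ofReal_prod_of_nonneg fun k _ => integral_nonneg h0]
  refine Finset.prod_congr rfl fun k _ => ?_
  rw [withDensity_apply _ (hs k),
    ofReal_integral_eq_lintegral_ofReal hi.restrict (Eventually.of_forall h0)]

theorem isProbabilityMeasure_withDensity_ofReal (h0 : ∀ t, 0 ≤ f t) (hi : Integrable f)
    (hone : ∫ t, f t = 1) :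
    IsProbabilityMeasure (volume.withDensity fun t => ENNReal.ofReal (f t)) := by
  constructor
  rw [withDensity_apply _ MeasurableSet.univ, setLIntegral_univ,
    ← ofReal_integral_eq_lintegral_ofReal hi (Eventually.of_forall h0), hone, ENNReal.ofReal_one]

end ProductDensity

/-- The strong law of large numbers for the coordinates of an infinite product measure. -/
theorem ae_tendsto_average_infinitePi {ν : Measure ℝ} [IsProbabilityMeasure ν] {φ : ℝ → ℝ}
    (hφ : Measurable φ) (hi : Integrable φ ν) :
    ∀ᵐ ω ∂(Measure.infinitePi fun _ : ℕ => ν),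
      Tendsto (fun n : ℕ => (∑ k : Fin n, φ (ω k)) / n) atTop (𝓝 (∫ t, φ t ∂ν)) := by
  have hmp := fun i : ℕ => measurePreserving_eval_infinitePi (fun _ : ℕ => ν) i
  have hind : iIndepFun (fun (i : ℕ) (ω : ℕ → ℝ) => φ (ω i)) (Measure.infinitePi fun _ : ℕ => ν) :=
    iIndepFun_infinitePi fun _ => hφ
  have hid : ∀ i, IdentDistrib (fun ω : ℕ → ℝ => φ (ω i)) (fun ω : ℕ → ℝ => φ (ω 0))
      (Measure.infinitePi fun _ : ℕ => ν) (Measure.infinitePi fun _ : ℕ => ν) := fun i => by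
    have h : IdentDistrib (fun ω : ℕ → ℝ => ω i) (fun ω : ℕ → ℝ => ω 0)
        (Measure.infinitePi fun _ : ℕ => ν) (Measure.infinitePi fun _ : ℕ => ν) :=
      ⟨(measurable_pi_apply i).aemeasurable, (measurable_pi_apply 0).aemeasurable,
        (hmp i).map_eq.trans (hmp 0).map_eq.symm⟩
    exact h.comp hφ
  have h := strong_law_ae_real (fun (i : ℕ) (ω : ℕ → ℝ) => φ (ω i))
    ((hmp 0).integrable_comp_of_integrable hi) (fun i j hij => hind.indepFun hij) hid
  have hint : ∫ ω, φ (ω 0) ∂(Measure.infinitePi fun _ : ℕ => ν) = ∫ t, φ t ∂ν := by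
    have h1 := integral_map (μ := Measure.infinitePi fun _ : ℕ => ν) (φ := fun ω : ℕ → ℝ => ω 0)
      (f := φ) (measurable_pi_apply 0).aemeasurable hφ.aestronglyMeasurable
    rw [← h1]
    exact congrArg (fun μ : Measure ℝ => ∫ t, φ t ∂μ) (hmp 0).map_eq
  filter_upwards [h] with ω hω
  rw [hint] at hω
  refine hω.congr fun n => ?_
  rw [Finset.sum_range]

/-- Product sets described by finitely many averages have asymptotically full measure. -/
theorem eventually_half_le_pi {ν : Measure ℝ} [IsProbabilityMeasure ν] {ι : Type*} [Finite ι]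
    {φ : ι → ℝ → ℝ} (hφ : ∀ i, Measurable (φ i)) (hi : ∀ i, Integrable (φ i) ν) {U : ι → Set ℝ}
    (hU : ∀ i, IsOpen (U i)) (hmem : ∀ i, ∫ t, φ i t ∂ν ∈ U i) :
    ∀ᶠ n : ℕ in atTop, 2⁻¹ ≤ Measure.pi (fun _ : Fin n => ν)
      {x | ∀ i, (∑ k, φ i (x k)) / n ∈ U i} := by
  set S : ∀ n : ℕ, Set (Fin n → ℝ) := fun n => {x | ∀ i, (∑ k, φ i (x k)) / n ∈ U i} with hS
  have hSm : ∀ n, MeasurableSet (S n) := fun n => by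
    have : S n = ⋂ i, {x | (∑ k, φ i (x k)) / n ∈ U i} := by
      ext x
      simp [hS]
    rw [this]
    refine MeasurableSet.iInter fun i => ?_
    have hm : Measurable fun x : Fin n → ℝ => (∑ k, φ i (x k)) / n :=
      (Finset.measurable_sum _ fun k _ => (hφ i).comp (measurable_pi_apply k)).div_const _
    exact hm (hU i).measurableSet
  have hrm : ∀ n : ℕ, Measurable fun (ω : ℕ → ℝ) (k : Fin n) => ω k := fun n =>
    measurable_pi_lambda _ fun k => measurable_pi_apply _
  set E : ℕ → Set (ℕ → ℝ) := fun n => (fun (ω : ℕ → ℝ) (k : Fin n) => ω k) ⁻¹' S n with hE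
  have hae : ∀ᵐ ω ∂(Measure.infinitePi fun _ : ℕ => ν), ∀ᶠ n in atTop, (ω ∈ E n ↔ ω ∈ Set.univ) := by
    have h := ae_all_iff.2 fun i => ae_tendsto_average_infinitePi (hφ i) (hi i)
    filter_upwards [h] with ω hω
    have h2 := eventually_all.2 fun i => (hω i).eventually_mem ((hU i).mem_nhds (hmem i))
    filter_upwards [h2] with n hn
    exact iff_of_true hn (Set.mem_univ _)
  -- Working on the infinite product puts all `n` on one space, so almost sure convergence yields
  -- convergence of the measures.
  have hlim := tendsto_measure_of_ae_tendsto_indicator_of_isFiniteMeasure atTop MeasurableSet.univ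
    (fun n => hrm n (hSm n)) hae
  rw [measure_univ] at hlim
  filter_upwards [hlim.eventually_const_le (u := 2⁻¹) (by simp)] with n hn
  refine hn.trans (le_of_eq ?_)
  rw [← Measure.infinitePi_eq_pi,
    ← Measure.map_infinitePi_infinitePi_of_inj (P := fun _ : ℕ => ν) (Fin.val_injective (n := n)),
    Measure.map_apply (hrm n) (hSm n)]

section Lower

variable {V : ℝ → ℝ} {p R y : ℝ} {f : ℝ → ℝ}

/-- The points of the Orlicz ball whose `p`-th mean lies in `G`. -/
def orliczBallMean (V : ℝ → ℝ) (p R : ℝ) (n : ℕ) (G : Set ℝ) : Set (Fin n → ℝ) :=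
  {x ∈ orliczBall V R n | (∑ k, |x k| ^ p) / n ∈ G}

/-- The typical set of the product density has mass at least `1 / 2`, and the density there is at
most `exp (-n (h(f) - δ))`, so its volume is large. The three parts of `δ` pay for the entropy
fluctuation, the factor `1 / 2` and the Jacobian of a contraction. -/
theorem IsAdmissible.eventually_le_volume (hf : IsAdmissible V p R y f) (hV : IsOrlicz V)
    (hR : 0 < R) {G : Set ℝ} (hG : IsOpen G) (hy : y ∈ G) {c : ℝ}
    (hc : c < densityEntropy f) :
    ∀ᶠ n : ℕ in atTop, ENNReal.ofReal (Real.exp (n * c)) ≤ volume (orliczBallMean V p R n G) := by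
  set δ := (densityEntropy f - c) / 3 with hδdef
  have hδ : 0 < δ := div_pos (sub_pos.2 hc) three_pos
  -- If `∫ V f = R`, the law of large numbers does not force `∑ V ≤ R n`. Since `V (l x) ≤ l V x`,
  -- contracting by `l < 1` relaxes the requirement to the mean being below `R / l`, at a volume
  -- cost of `l ^ n`.
  obtain ⟨l, hl0, hl1, hlδ, hly⟩ : ∃ l : ℝ, 0 < l ∧ l < 1 ∧ -δ < Real.log l ∧ l ^ p * y ∈ G := by
    have h1 : Tendsto Real.log (𝓝[<] 1) (𝓝 0) := by
      have := (Real.continuousAt_log one_ne_zero).tendsto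
      rw [Real.log_one] at this
      exact this.mono_left nhdsWithin_le_nhds
    have h2 : Tendsto (fun l : ℝ => l ^ p * y) (𝓝[<] 1) (𝓝 y) := by
      have := ((Real.continuousAt_rpow_const 1 p (Or.inl one_ne_zero)).mul_const y).tendsto
      rw [Real.one_rpow, one_mul] at this
      exact this.mono_left nhdsWithin_le_nhds
    have h3 : ∀ᶠ l : ℝ in 𝓝[<] 1, 0 < l :=
      nhdsWithin_le_nhds (Ioi_mem_nhds one_pos)
    obtain ⟨l, ha, hb, hc, hd⟩ := (h3.and (((h1.eventually_const_lt (neg_lt_zero.2 hδ))).and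
      ((h2.eventually_mem (hG.mem_nhds hy)).and self_mem_nhdsWithin))).exists
    exact ⟨l, ha, hd, hb, hc⟩
  have hprob := isProbabilityMeasure_withDensity_ofReal hf.nonneg hf.integrable hf.integral_eq_one
  have hlog : ∀ t, Real.log (f t) * f t = -Real.negMulLog (f t) := fun t => by
    unfold Real.negMulLog
    ring
  set φ : Fin 3 → ℝ → ℝ := ![V, fun t => |t| ^ p, fun t => Real.log (f t)] with hφ
  set U : Fin 3 → Set ℝ := ![Set.Iio (R / l), (fun z => l ^ p * z) ⁻¹' G,
    Set.Iio (-(densityEntropy f - δ))] with hU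
  have hfm := hf.measurable
  have key := eventually_half_le_pi (ν := volume.withDensity fun t => ENNReal.ofReal (f t))
    (φ := φ) (U := U)
    (by
      intro i
      fin_cases i
      · exact hV.continuous.measurable
      · exact measurable_abs_rpow p
      · exact Real.measurable_log.comp hfm)
    (by
      intro i
      rw [integrable_withDensity_ofReal_iff hfm hf.nonneg]
      fin_cases i
      · exact hf.integrable_V
      · exact hf.integrable_rpow
      · exact hf.integrable_negMulLog.neg.congr (Eventually.of_forall fun t => (hlog t).symm))
    (by
      intro i
      fin_cases i
      · exact isOpen_Iio
      · exact hG.preimage (continuous_const.mul continuous_id)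
      · exact isOpen_Iio)
    (by
      intro i
      rw [integral_withDensity_ofReal hfm hf.nonneg]
      fin_cases i
      · exact hf.integral_V_le.trans_lt ((lt_div_iff₀ hl0).2 (mul_lt_of_lt_one_right hR hl1))
      · change l ^ p * ∫ t, |t| ^ p * f t ∈ G
        rwa [hf.integral_rpow]
      · change ∫ t, Real.log (f t) * f t < _
        simp_rw [hlog]
        rw [integral_neg]
        exact neg_lt_neg (sub_lt_self _ hδ))
  have hexp : ∀ᶠ n : ℕ in atTop, Real.exp (-(n * δ)) ≤ 1 / 2 := by
    have h1 : Tendsto (fun n : ℕ => Real.exp (-(n * δ))) atTop (𝓝 0) :=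
      Real.tendsto_exp_neg_atTop_nhds_zero.comp
        (tendsto_natCast_atTop_atTop.atTop_mul_const hδ)
    exact h1.eventually_le_const (by norm_num)
  filter_upwards [key, hexp, eventually_ge_atTop 1] with n hn hne hn1
  have hn0 : (0 : ℝ) < n := by exact_mod_cast hn1
  set S : Set (Fin n → ℝ) := {x | ∀ i, (∑ k, φ i (x k)) / n ∈ U i} with hS
  rw [pi_withDensity_ofReal hf.nonneg hf.integrable n] at hn
  set e := densityEntropy f
  have hSvol : ENNReal.ofReal (Real.exp (n * (e - 2 * δ))) ≤ volume S := by
    have h1 : volume.withDensity (fun x : Fin n → ℝ => ENNReal.ofReal (∏ k, f (x k))) S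
        ≤ ENNReal.ofReal (Real.exp (-(n * (e - δ)))) * volume S := by
      rw [withDensity_apply', ← setLIntegral_const]
      refine setLIntegral_mono measurable_const fun x hx => ENNReal.ofReal_le_ofReal ?_
      -- Where some `f (x k)` vanishes, the convention `log 0 = 0` makes the logarithmic constraint
      -- uninformative, but then the product is zero.
      by_cases hz : ∃ k, f (x k) = 0
      · obtain ⟨k, hk⟩ := hz
        rw [Finset.prod_eq_zero (Finset.mem_univ k) hk]
        positivity
      · push Not at hz
        have hpos : ∀ k, 0 < f (x k) := fun k => lt_of_le_of_ne (hf.nonneg _) (hz k).symm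
        have h2 : (∑ k, Real.log (f (x k))) / n < -(e - δ) := hx 2
        rw [div_lt_iff₀ hn0] at h2
        rw [← Real.exp_log (Finset.prod_pos fun k _ => hpos k),
          Real.log_prod fun k _ => hz k, Real.exp_le_exp]
        linarith
    have h2 := hn.trans h1
    have h3 : ENNReal.ofReal (Real.exp (n * (e - δ))) * 2⁻¹ ≤ volume S := by
      calc ENNReal.ofReal (Real.exp (n * (e - δ))) * 2⁻¹
          ≤ ENNReal.ofReal (Real.exp (n * (e - δ)))
            * (ENNReal.ofReal (Real.exp (-(n * (e - δ)))) * volume S) := by gcongr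
        _ = volume S := by
            rw [← mul_assoc, ← ENNReal.ofReal_mul (Real.exp_pos _).le, ← Real.exp_add,
              add_neg_cancel, Real.exp_zero, ENNReal.ofReal_one, one_mul]
    refine le_trans ?_ h3
    have h4 : (2⁻¹ : ℝ≥0∞) = ENNReal.ofReal (1 / 2) := by
      rw [one_div, ENNReal.ofReal_inv_of_pos two_pos, ENNReal.ofReal_ofNat]
    rw [h4, ← ENNReal.ofReal_mul (Real.exp_pos _).le]
    refine ENNReal.ofReal_le_ofReal ?_
    have h5 : (n : ℝ) * (e - 2 * δ) = n * (e - δ) + -(n * δ) := by ring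
    rw [h5, Real.exp_add]
    exact mul_le_mul_of_nonneg_left hne (Real.exp_pos _).le
  have hsub : S ⊆ (fun x => l • x) ⁻¹' orliczBallMean V p R n G := by
    intro x hx
    have hx0 : (∑ k, V (x k)) / n < R / l := hx 0
    have hx1 : l ^ p * ((∑ k, |x k| ^ p) / n) ∈ G := hx 1
    refine ⟨?_, ?_⟩
    · change ∑ k, V (l * x k) ≤ R * n
      rw [div_lt_div_iff₀ hn0 hl0] at hx0
      calc ∑ k, V (l * x k) ≤ ∑ k, l * V (x k) :=
            Finset.sum_le_sum fun k _ => hV.apply_mul_le hl0.le hl1.le _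
        _ = (∑ k, V (x k)) * l := by rw [← Finset.mul_sum, mul_comm]
        _ ≤ R * n := hx0.le
    · change (∑ k, |l * x k| ^ p) / n ∈ G
      have : ∀ k, |l * x k| ^ p = l ^ p * |x k| ^ p := fun k => by
        rw [abs_mul, abs_of_pos hl0, Real.mul_rpow hl0.le (abs_nonneg _)]
      simp_rw [this]
      rwa [← Finset.mul_sum, mul_div_assoc]
  have hvol := (hSvol.trans (measure_mono hsub))
  rw [Measure.addHaar_preimage_smul volume hl0.ne', Module.finrank_fin_fun,
    abs_of_pos (by positivity)] at hvol
  calc ENNReal.ofReal (Real.exp (n * c))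
      ≤ ENNReal.ofReal (l ^ n) * ENNReal.ofReal (Real.exp (n * (e - 2 * δ))) := by
        rw [← ENNReal.ofReal_mul (by positivity)]
        refine ENNReal.ofReal_le_ofReal ?_
        rw [← Real.exp_log (pow_pos hl0 n), ← Real.exp_add, Real.exp_le_exp, Real.log_pow]
        have h3 : c = e - 3 * δ := by
          rw [hδdef]
          ring
        rw [h3]
        nlinarith
    _ ≤ ENNReal.ofReal (l ^ n)
          * (ENNReal.ofReal (l ^ n)⁻¹ * volume (orliczBallMean V p R n G)) := by gcongr
    _ = volume (orliczBallMean V p R n G) := by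
        rw [← mul_assoc, ← ENNReal.ofReal_mul (by positivity),
          mul_inv_cancel₀ (pow_pos hl0 n).ne', ENNReal.ofReal_one, one_mul]

end Lower

/-! ### The rate function -/

section Rate

variable {V : ℝ → ℝ} {p R : ℝ}

theorem iSup_gibbsDual_eq {α : ℝ} (hα : α < 0) (hmax : IsMaxOn (gibbsDual V R) (Set.Iio 0) α) :
    (⨆ β ∈ Set.Iio (0 : ℝ), (gibbsDual V R β : EReal)) = (gibbsDual V R α : EReal) :=
  le_antisymm (iSup₂_le fun _ hβ => EReal.coe_le_coe_iff.2 (hmax hβ))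
    (le_iSup₂ (f := fun β (_ : β ∈ Set.Iio (0 : ℝ)) => (gibbsDual V R β : EReal)) α hα)

theorem diffEntropy_le_of_forall
    (hVp : Tendsto (fun x : ℝ => V x / |x| ^ p) (cocompact ℝ) atTop)
    (hV : IsOrlicz V) (hp : 1 < p) (hR : 0 < R) {x : ℝ} (hx : 0 ≤ x) {c : ℝ}
    (h : ∀ f, IsAdmissible V p R (x ^ p) f → densityEntropy f ≤ c)
    {ν : ProbabilityMeasure ℝ} (hν : ν ∈ entropyConstraint V p R x) : diffEntropy ν ≤ (c : EReal) := by
  by_cases hbot : diffEntropy ν = ⊥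
  · rw [hbot]
    exact bot_le
  · obtain ⟨f, hf, he⟩ := exists_isAdmissible_of_mem_entropyConstraint hVp hV hp hR hx hν hbot
    rw [he]
    exact EReal.coe_le_coe_iff.2 (h f hf)

/-- Compactness with the moment held fixed. If no admissible density exists, all admissible measures
have entropy `⊥` and any of them is a maximiser. -/
theorem exists_isMaxOn_diffEntropy
    (hVp : Tendsto (fun x : ℝ => V x / |x| ^ p) (cocompact ℝ) atTop)
    (hV : IsOrlicz V) (hp : 1 < p) (hR : 0 < R) {x : ℝ} (hx : 0 ≤ x)
    (hne : (entropyConstraint V p R x).Nonempty) :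
    ∃ ν ∈ entropyConstraint V p R x, IsMaxOn diffEntropy (entropyConstraint V p R x) ν := by
  by_cases hS : ∃ f, IsAdmissible V p R (x ^ p) f
  · set S := {e | ∃ f, IsAdmissible V p R (x ^ p) f ∧ e = densityEntropy f} with hSdef
    have hSne : S.Nonempty := by
      obtain ⟨f, hf⟩ := hS
      exact ⟨_, f, hf, rfl⟩
    have hbdd : BddAbove S := by
      refine ⟨-gibbsDual V R (-1), ?_⟩
      rintro e ⟨f, hf, rfl⟩
      exact hf.densityEntropy_le hVp hV hp neg_one_lt_zero
    obtain ⟨f, hf, hc⟩ := exists_isAdmissible_of_forall_pos (R := R) (y := x ^ p) (c := sSup S)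
      hVp hV hp fun ε hε => by
        obtain ⟨e, ⟨f, hf, rfl⟩, he⟩ := exists_lt_of_lt_csSup hSne (sub_lt_self _ hε)
        exact ⟨x ^ p, f, by simpa using hε.le, hf, he.le⟩
    obtain ⟨ν, hν, hνe⟩ := hf.exists_mem_entropyConstraint hV hp hx
    refine ⟨ν, hν, fun ν' hν' => ?_⟩
    change diffEntropy ν' ≤ diffEntropy ν
    rw [hνe]
    exact diffEntropy_le_of_forall hVp hV hp hR hx
      (fun g hg => (le_csSup hbdd ⟨g, hg, rfl⟩).trans hc) hν'
  · obtain ⟨ν, hν⟩ := hne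
    refine ⟨ν, hν, fun ν' hν' => ?_⟩
    have : diffEntropy ν' = ⊥ := by
      by_contra hbot
      obtain ⟨f, hf, -⟩ := exists_isAdmissible_of_mem_entropyConstraint hVp hV hp hR hx hν' hbot
      exact hS ⟨f, hf⟩
    change diffEntropy ν' ≤ diffEntropy ν
    rw [this]
    exact bot_le

/-- Because the entropy maximum is attained, a bound on the rate is witnessed by one density, with a
non-strict inequality. This removes `EReal` arithmetic from most later arguments. -/
theorem thinShellRate_le_iff
    (hVp : Tendsto (fun x : ℝ => V x / |x| ^ p) (cocompact ℝ) atTop)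
    (hV : IsOrlicz V) (hp : 1 < p) (hR : 0 < R) {α : ℝ} (hα : α < 0)
    (hmax : IsMaxOn (gibbsDual V R) (Set.Iio 0) α) {x a : ℝ} :
    thinShellRate V p R x ≤ (a : EReal) ↔
      0 ≤ x ∧ ∃ f, IsAdmissible V p R (x ^ p) f ∧ -gibbsDual V R α - a ≤ densityEntropy f := by
  set M := gibbsDual V R α with hM
  by_cases hx : 0 ≤ x
  · rw [thinShellRate, if_pos hx, iSup_gibbsDual_eq hα hmax, ← hM]
    simp only [hx, true_and]
    constructor
    · intro h
      refine exists_isAdmissible_of_forall_pos hVp hV hp fun ε hε => ?_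
      have hlt : ((-M - a - ε : ℝ) : EReal) < ⨆ ν ∈ entropyConstraint V p R x, diffEntropy ν := by
        by_contra! hle
        have h1 : -(M : EReal) - ((-M - a - ε : ℝ) : EReal) ≤ (a : EReal) :=
          (EReal.sub_le_sub le_rfl hle).trans h
        rw [← EReal.coe_neg, ← EReal.coe_sub, EReal.coe_le_coe_iff] at h1
        linarith
      simp only [lt_iSup_iff] at hlt
      obtain ⟨ν, hν, hlt⟩ := hlt
      obtain ⟨f, hf, he⟩ := exists_isAdmissible_of_mem_entropyConstraint hVp hV hp hR hx hν
        (ne_bot_of_gt hlt)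
      rw [he, EReal.coe_lt_coe_iff] at hlt
      exact ⟨x ^ p, f, by simpa using hε.le, hf, hlt.le⟩
    · rintro ⟨f, hf, he⟩
      obtain ⟨ν, hν, hνe⟩ := hf.exists_mem_entropyConstraint hV hp hx
      have h1 : (densityEntropy f : EReal) ≤ ⨆ ν ∈ entropyConstraint V p R x, diffEntropy ν := by
        rw [← hνe]
        exact le_iSup₂ (f := fun ν (_ : ν ∈ entropyConstraint V p R x) => diffEntropy ν) ν hν
      refine (EReal.sub_le_sub le_rfl h1).trans ?_
      rw [← EReal.coe_neg, ← EReal.coe_sub, EReal.coe_le_coe_iff]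
      linarith
  · rw [thinShellRate, if_neg hx]
    simp [hx]

theorem isGoodRateFunction_thinShellRate
    (hVp : Tendsto (fun x : ℝ => V x / |x| ^ p) (cocompact ℝ) atTop)
    (hV : IsOrlicz V) (hp : 1 < p) (hR : 0 < R) : IsGoodRateFunction (thinShellRate V p R) := by
  obtain ⟨α, hα, hmax⟩ := exists_isMaxOn_gibbsDual (R := R) hVp hV hp hR
  have hα : α < 0 := hα
  refine ⟨fun x => ?_, fun a => ?_⟩
  · by_contra! h
    obtain ⟨r, h1, h2⟩ := EReal.lt_iff_exists_real_btwn.1 h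
    obtain ⟨hx, f, hf, he⟩ := (thinShellRate_le_iff hVp hV hp hR hα hmax).1 h1.le
    have h3 := hf.densityEntropy_le hVp hV hp hα
    have h4 : r < 0 := by exact_mod_cast h2
    linarith
  · obtain ⟨C, hC0, hC⟩ := exists_rpow_le_mul_add hVp hV hp one_pos
    -- The bounding interval comes from `x ≤ 1 + x ^ p` and the moment bound `x ^ p ≤ 1 * R + C`.
    refine Metric.isCompact_of_isClosed_isBounded (isClosed_of_closure_subset fun x hx => ?_)
      ((Metric.isBounded_Icc 0 (1 + (1 * R + C))).subset fun x hx => ?_)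
    · have hx0 : 0 ≤ x := by
        have : closure {x | thinShellRate V p R x ≤ (a : EReal)} ⊆ Set.Ici 0 :=
          closure_minimal (fun z hz => ((thinShellRate_le_iff hVp hV hp hR hα hmax).1 hz).1)
            isClosed_Ici
        exact this hx
      refine (thinShellRate_le_iff hVp hV hp hR hα hmax).2
        ⟨hx0, exists_isAdmissible_of_forall_pos hVp hV hp fun ε hε => ?_⟩
      have hcont : Continuous fun z : ℝ => z ^ p := Real.continuous_rpow_const (by linarith)
      obtain ⟨z, hz1, hz2⟩ := mem_closure_iff_nhds.1 hx _
        (hcont.continuousAt.preimage_mem_nhds (Metric.ball_mem_nhds (x ^ p) hε))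
      obtain ⟨-, f, hf, he⟩ := (thinShellRate_le_iff hVp hV hp hR hα hmax).1 hz2
      refine ⟨z ^ p, f, ?_, hf, by linarith⟩
      rw [← Real.dist_eq]
      exact (Metric.mem_ball.1 hz1).le
    · obtain ⟨h0, f, hf, -⟩ := (thinShellRate_le_iff hVp hV hp hR hα hmax).1 hx
      refine ⟨h0, ?_⟩
      have h1 := hf.moment_le zero_le_one hC
      have h2 := abs_le_one_add_rpow hp x
      rw [abs_of_nonneg h0] at h2
      linarith

end Rate

/-! ### The large deviation principle -/

section LDP

variable {V : ℝ → ℝ} {p R : ℝ} {n : ℕ}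

theorem le_log_div_of_exp_le (hn : n ≠ 0) {c : ℝ} {q : ℝ≥0∞}
    (h : ENNReal.ofReal (Real.exp (n * c)) ≤ q) : (c : EReal) ≤ ENNReal.log q / (n : EReal) := by
  have h1 := ENNReal.log_le_log h
  rw [ENNReal.log_ofReal_of_pos (Real.exp_pos _), Real.log_exp] at h1
  have hn0 : (0 : EReal) < (n : EReal) := by exact_mod_cast Nat.pos_of_ne_zero hn
  rw [EReal.le_div_iff_mul_le hn0 (EReal.natCast_ne_top n), mul_comm]
  exact_mod_cast h1

theorem log_div_le_of_le_exp (hn : n ≠ 0) {c : ℝ} {q : ℝ≥0∞}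
    (h : q ≤ ENNReal.ofReal (Real.exp (n * c))) : ENNReal.log q / (n : EReal) ≤ (c : EReal) := by
  have h1 := ENNReal.log_le_log h
  rw [ENNReal.log_ofReal_of_pos (Real.exp_pos _), Real.log_exp] at h1
  have hn0 : (0 : EReal) < (n : EReal) := by exact_mod_cast Nat.pos_of_ne_zero hn
  rw [EReal.div_le_iff_le_mul hn0 (EReal.natCast_ne_top n)]
  exact_mod_cast h1

theorem measurableSet_orliczBallMean (hV : IsOrlicz V) {G : Set ℝ} (hG : MeasurableSet G) :
    MeasurableSet (orliczBallMean V p R n G) := by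
  have hm : Measurable fun x : Fin n → ℝ => (∑ k, |x k| ^ p) / n :=
    (Finset.measurable_sum _ fun k _ =>
      (measurable_abs_rpow p).comp (measurable_pi_apply k)).div_const _
  exact (measurableSet_orliczBall hV).inter (hm hG)

theorem orliczBallMean_univ : orliczBallMean V p R n Set.univ = orliczBall V R n := by
  simp [orliczBallMean]

theorem volume_orliczBallMean_Icc_le
    (hVp : Tendsto (fun x : ℝ => V x / |x| ^ p) (cocompact ℝ) atTop)
    (hV : IsOrlicz V) (hp : 1 < p) (hR : 0 < R) (hn : n ≠ 0) {a b s : ℝ}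
    (h : ∀ y ∈ Set.Icc a b, ∀ f, IsAdmissible V p R y f → densityEntropy f ≤ s) :
    volume (orliczBallMean V p R n (Set.Icc a b)) ≤ ENNReal.ofReal (Real.exp (n * s)) := by
  by_cases h0 : volume (orliczBallMean V p R n (Set.Icc a b)) = 0
  · rw [h0]
    exact zero_le
  have hn0 : (0 : ℝ) < n := Nat.cast_pos.2 (Nat.pos_of_ne_zero hn)
  obtain ⟨htop, y, hy, f, hf, hlog⟩ := log_volume_le_densityEntropy hVp hV hp hR hn
    (measurableSet_orliczBallMean hV measurableSet_Icc) (fun x hx => hx.1) h0 (a := a) (b := b)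
    fun x hx => by
      have h1 := hx.2
      rw [Set.mem_Icc, le_div_iff₀ hn0, div_le_iff₀ hn0] at h1
      exact ⟨by linarith [h1.1], by linarith [h1.2]⟩
  rw [← ENNReal.ofReal_toReal htop]
  refine ENNReal.ofReal_le_ofReal ?_
  rw [← Real.log_le_iff_le_exp (ENNReal.toReal_pos h0 htop)]
  exact hlog.trans (mul_le_mul_of_nonneg_left (h y hy f hf) hn0.le)

/-- The bound does not depend on `n`, so exponential tightness is automatic. -/
theorem exists_mean_mem_Icc (hVp : Tendsto (fun x : ℝ => V x / |x| ^ p) (cocompact ℝ) atTop)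
    (hV : IsOrlicz V) (hp : 1 < p) :
    ∃ B : ℝ, ∀ n : ℕ, n ≠ 0 → ∀ x ∈ orliczBall V R n, (∑ k, |x k| ^ p) / n ∈ Set.Icc 0 B := by
  obtain ⟨C, hC0, hC⟩ := exists_rpow_le_mul_add hVp hV hp one_pos
  refine ⟨R + C, fun n hn x hx => ⟨by positivity, ?_⟩⟩
  have hn0 : (0 : ℝ) < n := Nat.cast_pos.2 (Nat.pos_of_ne_zero hn)
  rw [div_le_iff₀ hn0]
  have hx : ∑ k, V (x k) ≤ R * n := hx
  calc ∑ k, |x k| ^ p ≤ ∑ k, (V (x k) + C) :=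
        Finset.sum_le_sum fun k _ => by linarith [hC (x k)]
    _ = ∑ k, V (x k) + n * C := by
        rw [Finset.sum_add_distrib, Finset.sum_const, Finset.card_univ, Fintype.card_fin,
          nsmul_eq_mul]
    _ ≤ (R + C) * n := by linarith

theorem volume_orliczBall_le (hVp : Tendsto (fun x : ℝ => V x / |x| ^ p) (cocompact ℝ) atTop)
    (hV : IsOrlicz V) (hp : 1 < p) (hR : 0 < R) {α : ℝ} (hα : α < 0) (hn : n ≠ 0) :
    volume (orliczBall V R n) ≤ ENNReal.ofReal (Real.exp (n * -gibbsDual V R α)) := by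
  obtain ⟨B, hB⟩ := exists_mean_mem_Icc (R := R) hVp hV hp
  exact (measure_mono (t := orliczBallMean V p R n (Set.Icc 0 B))
    fun x hx => ⟨hx, hB n hn x hx⟩).trans
    (volume_orliczBallMean_Icc_le hVp hV hp hR hn (a := 0) (b := B)
      fun y _ f hf => hf.densityEntropy_le hVp hV hp hα)

theorem measure_preimage_norm_eq (hV : IsOrlicz V) (hp : 1 < p)
    {Ω : Type*} [MeasurableSpace Ω] {P : Measure Ω} {X : Ω → Fin n → ℝ} (hXm : Measurable X)
    (hX : pdf.IsUniform X (orliczBall V R n) P volume) {A : Set ℝ} (hA : MeasurableSet A) :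
    P ((fun ω => (n : ℝ) ^ (-(1 / p)) *
        ‖(WithLp.toLp (ENNReal.ofReal p) (X ω) : PiLp (ENNReal.ofReal p) fun _ : Fin n => ℝ)‖)
          ⁻¹' A)
      = (volume (orliczBall V R n))⁻¹ *
        volume (orliczBallMean V p R n ((fun z => z ^ (1 / p)) ⁻¹' A)) := by
  have hp0 : 0 < p := by linarith
  have hnorm : ∀ x : Fin n → ℝ, (n : ℝ) ^ (-(1 / p)) *
      ‖(WithLp.toLp (ENNReal.ofReal p) x : PiLp (ENNReal.ofReal p) fun _ : Fin n => ℝ)‖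
      = ((∑ k, |x k| ^ p) / n) ^ (1 / p) := fun x => by
    have h1 : (ENNReal.ofReal p).toReal = p := ENNReal.toReal_ofReal hp0.le
    rw [PiLp.norm_eq_sum (by rwa [h1]), h1,
      Real.div_rpow (Finset.sum_nonneg fun k _ => by positivity) (Nat.cast_nonneg n),
      Real.rpow_neg (Nat.cast_nonneg n), div_eq_mul_inv, mul_comm]
    rfl
  have hmean : Measurable fun x : Fin n → ℝ => ((∑ k, |x k| ^ p) / n) ^ (1 / p) :=
    ((Finset.measurable_sum _ fun k _ =>
      (measurable_abs_rpow p).comp (measurable_pi_apply k)).div_const _).pow_const _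
  have hmap : P.map X = volume[|orliczBall V R n] := hX
  simp_rw [hnorm]
  change P (X ⁻¹' ((fun x : Fin n → ℝ => ((∑ k, |x k| ^ p) / n) ^ (1 / p)) ⁻¹' A)) = _
  rw [← Measure.map_apply hXm (hmean hA), hmap, cond_apply (measurableSet_orliczBall hV)]
  rfl

/-- Closed sets on which the rate exceeds `a` capture exponentially small volume. -/
theorem exists_volume_le_card_mul_exp
    (hVp : Tendsto (fun x : ℝ => V x / |x| ^ p) (cocompact ℝ) atTop)
    (hV : IsOrlicz V) (hp : 1 < p) (hR : 0 < R) {α : ℝ} (hα : α < 0)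
    (hmax : IsMaxOn (gibbsDual V R) (Set.Iio 0) α) {F : Set ℝ} (hF : IsClosed F) {a : ℝ}
    (ha : ∀ x ∈ F, (a : EReal) < thinShellRate V p R x) :
    ∃ N : ℕ, ∀ n : ℕ, n ≠ 0 → volume (orliczBallMean V p R n ((fun z => z ^ (1 / p)) ⁻¹' F))
      ≤ N * ENNReal.ofReal (Real.exp (n * (-gibbsDual V R α - a))) := by
  have hp0 : 0 < p := by linarith
  obtain ⟨B, hB⟩ := exists_mean_mem_Icc (R := R) hVp hV hp
  have hcont : Continuous fun z : ℝ => z ^ (1 / p) := Real.continuous_rpow_const (by positivity)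
  set K : Set ℝ := Set.Icc 0 B ∩ (fun z => z ^ (1 / p)) ⁻¹' F with hK
  have hKc : IsCompact K := isCompact_Icc.inter_right (hF.preimage hcont)
  set U : Set ℝ := (fun z => z ^ (1 / p)) ⁻¹' {x | thinShellRate V p R x ≤ (a : EReal)}ᶜ with hU
  have hUo : IsOpen U := (((isGoodRateFunction_thinShellRate hVp hV hp hR).isCompact_sublevel
    a).isClosed.isOpen_compl).preimage hcont
  have hex : ∀ z ∈ K, ∃ r > 0, Set.Icc (z - r) (z + r) ⊆ U := fun z hz => by
    obtain ⟨r, hr, hrU⟩ := Metric.nhds_basis_closedBall.mem_iff.1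
      (hUo.mem_nhds (show z ∈ U from not_le.2 (ha _ hz.2)))
    exact ⟨r, hr, by rwa [← Real.closedBall_eq_Icc]⟩
  choose! r hr hrU using hex
  obtain ⟨t, htK, ht⟩ := hKc.elim_nhds_subcover (fun z => Set.Icc (z - r z) (z + r z))
    fun z hz => Icc_mem_nhds (by linarith [hr z hz]) (by linarith [hr z hz])
  refine ⟨t.card, fun n hn => ?_⟩
  have hsub : orliczBallMean V p R n ((fun z => z ^ (1 / p)) ⁻¹' F)
      ⊆ ⋃ z ∈ t, orliczBallMean V p R n (Set.Icc (z - r z) (z + r z)) := fun x hx => by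
    obtain ⟨z, hz, hxz⟩ := Set.mem_iUnion₂.1 (ht ⟨hB n hn x hx.1, hx.2⟩)
    exact Set.mem_iUnion₂.2 ⟨z, hz, hx.1, hxz⟩
  refine (measure_mono hsub).trans ((measure_biUnion_finset_le t _).trans ?_)
  rw [← nsmul_eq_mul]
  refine Finset.sum_le_card_nsmul _ _ _ fun z hz => ?_
  refine volume_orliczBallMean_Icc_le hVp hV hp hR hn fun y hy f hf => ?_
  -- A density violating the bound would witness, at the point `y ^ (1 / p)`, a rate of at most `a`,
  -- although the interval avoids that sublevel set.
  by_contra! hlt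
  refine hrU z (htK z hz) hy ((thinShellRate_le_iff hVp hV hp hR hα hmax).2
    ⟨Real.rpow_nonneg hf.nonneg_moment _, f, ?_, hlt.le⟩)
  rwa [← Real.rpow_mul hf.nonneg_moment, one_div_mul_cancel hp0.ne', Real.rpow_one]

theorem satisfiesLDP_orliczBall (hV : IsOrlicz V) (hp : 1 < p)
    (hVp : Tendsto (fun x : ℝ => V x / |x| ^ p) (cocompact ℝ) atTop) (hR : 0 < R)
    {Ω : ℕ → Type*} [∀ n, MeasurableSpace (Ω n)]
    (P : ∀ n, Measure (Ω n)) [∀ n, IsProbabilityMeasure (P n)]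
    (X : ∀ n, Ω n → (Fin n → ℝ)) (hXm : ∀ n, Measurable (X n))
    (hX : ∀ n, 1 ≤ n → pdf.IsUniform (X n) (orliczBall V R n) (P n) volume) :
    SatisfiesLDP P
      (fun n ω => (n : ℝ) ^ (-(1 / p)) *
        ‖(WithLp.toLp (ENNReal.ofReal p) (X n ω) : PiLp (ENNReal.ofReal p) fun _ : Fin n => ℝ)‖)
      (thinShellRate V p R) := by
  have hp0 : 0 < p := by linarith
  obtain ⟨α, hα, hmax⟩ := exists_isMaxOn_gibbsDual (R := R) hVp hV hp hR
  have hα : α < 0 := hα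
  have hcont : Continuous fun z : ℝ => z ^ (1 / p) := Real.continuous_rpow_const (by positivity)
  set M := gibbsDual V R α with hM
  refine ⟨isGoodRateFunction_thinShellRate hVp hV hp hR, fun A _ => ?_, fun A _ => ?_⟩
  · refine le_of_forall_lt_imp_le_of_dense fun b hb => ?_
    rw [EReal.lt_neg_comm] at hb
    simp only [iInf_lt_iff] at hb
    obtain ⟨x, hxA, hx⟩ := hb
    obtain ⟨a', h1, h2⟩ := EReal.lt_iff_exists_real_btwn.1 hx
    -- The gap `a < a'` turns the non-strict entropy bound into the strict one needed for the volume
    -- estimate.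
    obtain ⟨a, h3, h4⟩ := EReal.lt_iff_exists_real_btwn.1 h1
    obtain ⟨hx0, f, hf, he⟩ := (thinShellRate_le_iff hVp hV hp hR hα hmax).1 h3.le
    have h4 : a < a' := EReal.coe_lt_coe_iff.1 h4
    have hev := hf.eventually_le_volume hV hR (isOpen_interior.preimage hcont)
      (show x ^ p ∈ (fun z : ℝ => z ^ (1 / p)) ⁻¹' interior A by
        rw [Set.mem_preimage, ← Real.rpow_mul hx0, mul_one_div_cancel hp0.ne', Real.rpow_one]
        exact hxA) (c := -M - a') (by linarith)
    have hba : b ≤ ((-a' : ℝ) : EReal) := by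
      rw [EReal.coe_neg]
      exact (EReal.lt_neg_comm.1 h2).le
    refine le_liminf_of_le (by isBoundedDefault) ?_
    filter_upwards [hev, eventually_ge_atTop 1] with n hn hn1
    have hn0 : n ≠ 0 := by omega
    refine hba.trans (le_log_div_of_exp_le hn0 ?_)
    rw [measure_preimage_norm_eq hV hp (hXm n) (hX n hn1) isOpen_interior.measurableSet]
    have hvol := volume_orliczBall_le hVp hV hp hR hα hn0
    calc ENNReal.ofReal (Real.exp (n * -a'))
        = (ENNReal.ofReal (Real.exp (n * -M)))⁻¹ * ENNReal.ofReal (Real.exp (n * (-M - a'))) := by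
          rw [← ENNReal.ofReal_inv_of_pos (Real.exp_pos _), ← Real.exp_neg,
            ← ENNReal.ofReal_mul (Real.exp_pos _).le, ← Real.exp_add]
          congr 2
          ring
      _ ≤ _ := mul_le_mul' (ENNReal.inv_le_inv.2 hvol) hn
  · refine le_of_forall_gt_imp_ge_of_dense fun b hb => ?_
    rw [EReal.neg_lt_comm] at hb
    obtain ⟨a', h1, h2⟩ := EReal.lt_iff_exists_real_btwn.1 hb
    obtain ⟨a, h3, h4⟩ := EReal.lt_iff_exists_real_btwn.1 h2
    have h3 : a' < a := EReal.coe_lt_coe_iff.1 h3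
    obtain ⟨N, hN⟩ := exists_volume_le_card_mul_exp hVp hV hp hR hα hmax
      (isClosed_closure (s := A)) fun x hx => h4.trans_le (iInf₂_le x hx)
    obtain ⟨y, f, hf, he⟩ := exists_isAdmissible_of_isMaxOn hVp hV hp hα hmax
    -- One half of the gap absorbs the number `N` of covering intervals, the other the error in the
    -- lower bound for the volume of the ball.
    set δ := (a - a') / 2 with hδdef
    have hδ : 0 < δ := half_pos (sub_pos.2 h3)
    have hev := hf.eventually_le_volume hV hR isOpen_univ (Set.mem_univ y) (c := -M - δ)
      (by linarith)
    have hNe : ∀ᶠ n : ℕ in atTop, (N : ℝ) ≤ Real.exp (n * δ) :=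
      (Real.tendsto_exp_atTop.comp
        (tendsto_natCast_atTop_atTop.atTop_mul_const hδ)).eventually_ge_atTop (N : ℝ)
    have hba : ((-a' : ℝ) : EReal) ≤ b := by
      rw [EReal.coe_neg]
      exact (EReal.neg_lt_comm.1 h1).le
    refine limsup_le_of_le (by isBoundedDefault) ?_
    filter_upwards [hev, hNe, eventually_ge_atTop 1] with n hn hnN hn1
    have hn0 : n ≠ 0 := by omega
    refine (log_div_le_of_le_exp hn0 ?_).trans hba
    rw [measure_preimage_norm_eq hV hp (hXm n) (hX n hn1) isClosed_closure.measurableSet]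
    rw [orliczBallMean_univ] at hn
    calc _ ≤ (ENNReal.ofReal (Real.exp (n * (-M - δ))))⁻¹ *
          (ENNReal.ofReal (Real.exp (n * δ)) * ENNReal.ofReal (Real.exp (n * (-M - a)))) := by
          refine mul_le_mul' (ENNReal.inv_le_inv.2 hn) ((hN n hn0).trans ?_)
          gcongr
          rw [← ENNReal.ofReal_natCast]
          exact ENNReal.ofReal_le_ofReal hnN
      _ = ENNReal.ofReal (Real.exp (n * -a')) := by
          rw [← ENNReal.ofReal_inv_of_pos (Real.exp_pos _), ← Real.exp_neg,
            ← ENNReal.ofReal_mul (Real.exp_pos _).le, ← ENNReal.ofReal_mul (Real.exp_pos _).le,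
            ← Real.exp_add, ← Real.exp_add]
          congr 2
          rw [hδdef]
          ring

end LDP

theorem mainTheorem5
    (V : ℝ → ℝ) (hV : IsOrlicz V) (p : ℝ) (hp : 1 < p)
    (hVp : Tendsto (fun x : ℝ => V x / |x| ^ p) (cocompact ℝ) atTop)
    (R : ℝ) (hR : 0 < R)
    {Ω : ℕ → Type*} [∀ n, MeasurableSpace (Ω n)]
    (P : ∀ n, Measure (Ω n)) [∀ n, IsProbabilityMeasure (P n)]
    (X : ∀ n, Ω n → (Fin n → ℝ)) (hXm : ∀ n, Measurable (X n))
    (hX : ∀ n, 1 ≤ n → pdf.IsUniform (X n) (orliczBall V R n) (P n) volume) :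
    (∃ α ∈ Set.Iio (0 : ℝ), IsMaxOn (gibbsDual V R) (Set.Iio 0) α) ∧
    (∀ x : ℝ, 0 ≤ x → (entropyConstraint V p R x).Nonempty →
      ∃ ν ∈ entropyConstraint V p R x, IsMaxOn diffEntropy (entropyConstraint V p R x) ν) ∧
    SatisfiesLDP P
      (fun n ω => (n : ℝ) ^ (-(1 / p)) *
        ‖(WithLp.toLp (ENNReal.ofReal p) (X n ω) : PiLp (ENNReal.ofReal p) fun _ : Fin n => ℝ)‖)
      (thinShellRate V p R) :=
  ⟨exists_isMaxOn_gibbsDual hVp hV hp hR,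
    fun _ hx hne => exists_isMaxOn_diffEntropy hVp hV hp hR hx hne,
    satisfiesLDP_orliczBall hV hp hVp hR P X hXm hX⟩
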